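/- Let $\Sigma$ be a finite set, $n\ge 1$, and let $\mu$ be a probability distribution on $\Sigma^n$. The Glauber dynamics for $\mu$ is the Markov chain with transition matrix $P=P_\mu$ that, from $x\in\Sigma^n$, picks $i\in\{1,\dots,n\}$ uniformly and moves to a sample of $\mu$ conditioned on agreeing with $x$ off coordinate $i$; its continuous-time version is $P_t=e^{t(P-I)}$, and $P_t\pi$ denotes the law at time $t$ when started from $\pi$. Write $\mathrm{Ent}_\mu[f]=\mathbb E_\mu[f\log f]-\mathbb E_\mu[f]\log\mathbb E_\mu[f]$ and $\mathcal E_{P}(f,g)=\mathbb E_{x\sim\mu}\mathbb E_{y\sim P(x,\cdot)}[(f(x)-f(y))(g(x)-g(y))]$. We say that $\mu$ satisfies a modified log-Sobolev inequality (MLSI) with constant $c^*$ if $\mathrm{Ent}_\mu[f]\le c^*\,\mathcal E_{P_\mu}(f,\log f)$ for all $f:\Sigma^n\to\mathbb R_{\ge 0}$ (with $\log 0=-\infty$, so that the right-hand side may be $+\infty$). **Theorem.** There are absolute constants $C_1,C_2>0$ such that the following holds. Let $\mu=\sum_{a=1}^k\rho(a)\mu_a$ be a mixture of $k$ probability distributions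 on $\Sigma^n$, each of which satisfies an MLSI with constant $c^*>0$. Let $\varepsilon>0$ and $0<\delta<1$, let $x_1,\dots,x_m$ be i.i.d. samples from $\mu$, and let $\pi=\frac1m\sum_{j=1}^m\delta_{x_j}$ be their empirical distribution. Let $P_t$ be the continuous-time Glauber dynamics for $\mu$, and let $\mu_{\min}=\min\{\mu(x):\mu(x)>0\}$. If $$m\ \ge\ C_1\Big(\frac{k}{\varepsilon}+\frac{\log(1/\delta)}{\varepsilon}\Big)\qquad\text{and}\qquad t\ \ge\ C_2\,c^*n\cdot\max\{1,\ \log\log(1/\mu_{\min})+\log(1/\varepsilon)\},$$ then $$\Pr_{x_1,\dots,x_m}\big[\mathrm{KL}(P_t\pi\,\|\,\mu)>\varepsilon\big]\ \le\ \delta .$$ (If $\mu$ is a point mass, $\log\log(1/\mu_{\min})$ is read as $0$.) -/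

import Mathlib

namespace GlauberMixture

open MeasureTheory

noncomputable section

/-- The measure on a finite space with point masses `w x`. -/
def toMeasure {Ω : Type*} [Fintype Ω] [MeasurableSpace Ω] (w : Ω → ℝ) : Measure Ω :=
  ∑ x, ENNReal.ofReal (w x) • Measure.dirac x

/-- The `ρ`-mixture of the distributions `ν a`. -/
def mixture {Ω ι : Type*} [Fintype ι] (ρ : ι → ℝ) (ν : ι → Ω → ℝ) : Ω → ℝ :=
  fun x => ∑ a, ρ a * ν a x

/-- The smallest positive mass of a distribution on a finite space. -/
def minMass {Ω : Type*} (μ : Ω → ℝ) : ℝ :=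
  sInf (μ '' {x | 0 < μ x})

/-- The empirical distribution of the samples `x 0, …, x (m - 1)`. -/
def empirical {Ω : Type*} [DecidableEq Ω] {m : ℕ} (x : Fin m → Ω) : Ω → ℝ :=
  fun z => (1 / (m : ℝ)) * ∑ j, if x j = z then 1 else 0

/-- The entropy `E_μ[f log f] - E_μ[f] log E_μ[f]` (with `0 log 0 = 0`). -/
def entropy {Ω : Type*} [Fintype Ω] (μ f : Ω → ℝ) : ℝ :=
  (∑ x, μ x * (f x * Real.log (f x))) - (∑ x, μ x * f x) * Real.log (∑ x, μ x * f x)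

/-- The Dirichlet form `E_{x ∼ μ} E_{y ∼ P(x, ·)} [(f x - f y) (g x - g y)]`. -/
def dirichletForm {Ω : Type*} [Fintype Ω] (μ : Ω → ℝ) (P : Matrix Ω Ω ℝ) (f g : Ω → ℝ) : ℝ :=
  ∑ x, ∑ y, μ x * P x y * ((f x - f y) * (g x - g y))

section Glauber

variable {n : ℕ} {S : Type*} [Fintype S] [DecidableEq S]

/-- The `μ`-mass of the set of configurations that agree with `x` off the coordinate `i`. -/
def lineMass (μ : (Fin n → S) → ℝ) (i : Fin n) (x : Fin n → S) : ℝ :=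
  ∑ s, μ (Function.update x i s)

/-- Resampling of the coordinate `i`: from `x` one moves to a sample of `μ` conditioned on agreeing
with `x` off `i`. Where this conditioning is undefined (possible only outside the support of `μ`)
the chain stays put. -/
def resample (μ : (Fin n → S) → ℝ) (i : Fin n) : Matrix (Fin n → S) (Fin n → S) ℝ :=
  fun x y =>
    if lineMass μ i x = 0 then (if y = x then 1 else 0)
    else if ∀ j, j ≠ i → y j = x j then μ y / lineMass μ i x else 0

/-- Transition matrix of the Glauber dynamics: resample a uniformly random coordinate. -/
def glauber (μ : (Fin n → S) → ℝ) : Matrix (Fin n → S) (Fin n → S) ℝ :=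
  (1 / (n : ℝ)) • ∑ i, resample μ i

/-- The law `P_t π` at time `t` of the continuous-time Glauber dynamics for `μ` started from `π`,
where `P_t = exp (t (P - I))`; distributions are row vectors. -/
def glauberLaw (μ : (Fin n → S) → ℝ) (t : ℝ) (π : (Fin n → S) → ℝ) : (Fin n → S) → ℝ :=
  Matrix.vecMul π (NormedSpace.exp (t • (glauber μ - 1)))

/-- The modified log-Sobolev inequality with constant `c` for the Glauber dynamics of `μ`,
`Ent_μ[f] ≤ c * 𝓔_P(f, log f)`. It suffices to ask it of positive `f`: with the convention
`log 0 = -∞`, the inequality for nonnegative `f` follows by applying it to `f + δ` and letting `δ`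
tend to `0`, as each term of the Dirichlet form then increases to its value (possibly `∞`)
at `f`. -/
def SatisfiesMLSI (μ : (Fin n → S) → ℝ) (c : ℝ) : Prop :=
  ∀ f : (Fin n → S) → ℝ, (∀ x, 0 < f x) →
    entropy μ f ≤ c * dirichletForm μ (glauber μ) f (fun x => Real.log (f x))

end Glauber

end

end GlauberMixture

/-! ### Scalar inequalities for `klFun` and for the integrand of the Dirichlet form -/

namespace GlauberMixture

open InformationTheory

/-! Let f be the density of π with respect to μ. The mixture is not assumed to satisfy an MLSI, but
the chain rule splits its entropy into the average of the entropies under the μ_a, each controlled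
by an MLSI, and the entropy between components, Σ ρ(a) klFun(E_{μ_a} f). So entropy relaxes towards
the latter term, provided that the Dirichlet forms of the μ_a are controlled by that of μ and that
the term is small along the whole trajectory.

Dirichlet forms. For one coordinate, let F be the conditional average of f under μ. The form of μ
equals 2 E_μ[(f - F)(log f - log F)], which is linear in μ and so splits over the components; a
quasi-triangle inequality through F then bounds the form of each μ_a, at cost L whenever F ≤ L f
(`logDiff_le_through`, `sum_dirichletForm_le`). To ensure L = 2n, the chain is followed not on P_t f
but on g = P_t (2 - P)⁻¹ (1 + f)/2: since (2 - P) g = P_t (1 + f)/2 ≥ 0, one has P g ≤ 2g, hence F ≤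
n P g ≤ 2n g. Nothing is lost, because P_t f = 2(2g - Pg) - 1 is an extrapolation from g, Pg and 1,
and `klFun` at such points is bounded by its values at the data (`klFun_two_mul_sub_le`,
`sum_klFun_exp_mulVec_le`).

Entropy between components. At each time the averages over the components are empirical means of
posterior weights b_a(x_j) with Σ ρ(a) b_a = 1. By Jensen their joint moment generating function is
at most that of independent Poisson variables, and peeling each `klFun` by its Legendre dual e^g - 1
gives an exponential moment at most e^{3k} (`sum_prod_mul_exp_klFun_le`). A Grönwall argument
carried out on the exponential moment itself (`sum_exp_le_of_deriv_le`) passes this to the entropy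
at time t with no union bound over times. Markov's inequality concludes. -/

lemma klFun_le_sq {u : ℝ} (hu : 0 ≤ u) : klFun u ≤ (u - 1) ^ 2 := by
  rcases hu.eq_or_lt with rfl | hu
  · simp [klFun_zero]
  · have := Real.log_le_sub_one_of_pos hu
    rw [klFun_apply]
    nlinarith

lemma sqrt_sub_one_sq_le_klFun {u : ℝ} (hu : 0 ≤ u) : (√u - 1) ^ 2 ≤ klFun u := by
  rcases hu.eq_or_lt with rfl | hu
  · simp [klFun_zero]
  · have hs : 0 < √u := Real.sqrt_pos.2 hu
    have h1 := Real.one_sub_inv_le_log_of_pos hs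
    have h2 : Real.log u = 2 * Real.log √u := by rw [Real.log_sqrt hu.le]; ring
    have h3 : √u ^ 2 = u := Real.sq_sqrt hu.le
    have h4 : √u - 1 ≤ √u * Real.log √u := by
      have := mul_le_mul_of_nonneg_left h1 hs.le
      rwa [mul_sub, mul_inv_cancel₀ hs.ne', mul_one] at this
    rw [klFun_apply, h2]
    nlinarith

/-- Factor u - 1 = (√u - 1)(√u + 1). With `klFun_le_sq`, this makes `klFun` comparable to a
quadratic on bounded ranges. -/
lemma sub_one_sq_le_mul_klFun {u b : ℝ} (hu : 0 ≤ u) (hb : 0 ≤ b) (hub : u ≤ b ^ 2) :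
    (u - 1) ^ 2 ≤ (b + 1) ^ 2 * klFun u := by
  have h1 := sqrt_sub_one_sq_le_klFun hu
  have h3 : √u ^ 2 = u := Real.sq_sqrt hu
  have h4 : √u ≤ b := Real.sqrt_le_iff.2 ⟨hb, hub⟩
  calc (u - 1) ^ 2 = (√u + 1) ^ 2 * (√u - 1) ^ 2 := by
        nth_rw 1 [← h3]
        ring
    _ ≤ (b + 1) ^ 2 * klFun u := by gcongr

/-- The entropy function at an extrapolated point is controlled by its values at the two points,
as long as the extrapolated point stays nonnegative. -/
lemma klFun_two_mul_sub_le {g p : ℝ} (hg : 0 ≤ g) (hp : 0 ≤ p) (h : 0 ≤ 2 * g - p) :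
    klFun (2 * g - p) ≤ 72 * (klFun g + klFun p) := by
  have hpk := klFun_nonneg hp
  have hgk := klFun_nonneg hg
  -- For g ≤ 4 all arguments are at most 8 and the quadratic comparison applies: the squared
  -- increment is at most 8(g - 1)² + 2(p - 1)², and 72 = 8 · 9. For g > 4 the term g log g
  -- dominates everything.
  rcases le_or_gt g 4 with h4 | h4
  · have h1 := klFun_le_sq h
    have h2 := sub_one_sq_le_mul_klFun (b := 2) hg (by norm_num) (by linarith)
    have h3 := sub_one_sq_le_mul_klFun (b := 3) hp (by norm_num) (by linarith)
    nlinarith [sq_nonneg (2 * (g - 1) + (p - 1))]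
  · have hl2 := Real.log_two_gt_d9
    have hl2' := Real.log_two_lt_d9
    have hlg : 2 * Real.log 2 ≤ Real.log g := by
      have : Real.log 4 ≤ Real.log g := Real.log_le_log (by norm_num) h4.le
      rwa [show (4 : ℝ) = 2 ^ 2 by norm_num, Real.log_pow, Nat.cast_ofNat] at this
    have hl : (2 * g - p) * Real.log (2 * g - p) ≤ 2 * g * (Real.log 2 + Real.log g) := by
      rcases h.eq_or_lt with h0 | h0
      · rw [← h0]
        have : 0 ≤ Real.log 2 + Real.log g := by linarith
        simp only [zero_mul]
        positivity
      · rw [← Real.log_mul (by norm_num) (by linarith)]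
        have h5 : Real.log (2 * g - p) ≤ Real.log (2 * g) := Real.log_le_log h0 (by linarith)
        have h6 : 0 ≤ Real.log (2 * g) := Real.log_nonneg (by linarith)
        calc (2 * g - p) * Real.log (2 * g - p) ≤ (2 * g - p) * Real.log (2 * g) := by gcongr
          _ ≤ 2 * g * Real.log (2 * g) := by gcongr; linarith
    rw [klFun_apply (2 * g - p), klFun_apply g]
    nlinarith [mul_le_mul_of_nonneg_left hlg hg]

lemma klFun_convex_combination {a b : ℝ} (ha : 0 ≤ a) (hb : 0 ≤ b) :
    klFun ((a + b) / 2) ≤ (klFun a + klFun b) / 2 := by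
  have := convexOn_klFun.2 ha hb (by norm_num : (0 : ℝ) ≤ 1 / 2) (by norm_num : (0 : ℝ) ≤ 1 / 2)
    (by norm_num)
  simp only [smul_eq_mul] at this
  rw [show (a + b) / 2 = 1 / 2 * a + 1 / 2 * b by ring]
  linarith

/-- The integrand `(a - b) (log a - log b)` of the Dirichlet form of `f` and `log f`. -/
noncomputable def logDiff (a b : ℝ) : ℝ := (a - b) * (Real.log a - Real.log b)

lemma logDiff_comm (a b : ℝ) : logDiff a b = logDiff b a := by unfold logDiff; ring

lemma logDiff_nonneg {a b : ℝ} (ha : 0 < a) (hb : 0 < b) : 0 ≤ logDiff a b := by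
  rcases le_total a b with h | h
  · exact mul_nonneg_of_nonpos_of_nonpos (by linarith)
      (by linarith [Real.log_le_log ha h])
  · exact mul_nonneg (by linarith) (by linarith [Real.log_le_log hb h])

lemma logDiff_mono {a b c : ℝ} (hc : 0 < c) (hcb : c ≤ b) (hba : b ≤ a) :
    logDiff a b ≤ logDiff a c := by
  have h1 := Real.log_le_log hc hcb
  have h2 := Real.log_le_log (hc.trans_le hcb) hba
  unfold logDiff
  apply mul_le_mul <;> linarith

lemma logDiff_mul {c a b : ℝ} (hc : 0 < c) (ha : 0 < a) (hb : 0 < b) :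
    logDiff (c * a) (c * b) = c * logDiff a b := by
  unfold logDiff
  rw [Real.log_mul hc.ne' ha.ne', Real.log_mul hc.ne' hb.ne']
  ring

/-- With l = -log v, expanding around 1 leaves the diagonal terms S = (u - 1) log u + (1 - v) l and
the cross terms (u - 1) l and (1 - v) log u, the second being at most the first. For u ≤ 2 the first
is handled by AM-GM with l ≤ L(1 - v), for u > 2 by l ≤ L and log u ≥ 1/2. Each cross term is thus
at most 2L S, and S ≤ L S. -/
lemma logDiff_le_through_one {u v L : ℝ} (hL : 1 ≤ L) (hu : 1 ≤ u) (hv : 1 / L ≤ v)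
    (hv1 : v ≤ 1) : logDiff u v ≤ 5 * L * (logDiff u 1 + logDiff v 1) := by
  have hL0 : 0 < L := by linarith
  have hv0 : 0 < v := lt_of_lt_of_le (by positivity) hv
  have hu0 : 0 < u := by linarith
  set l := -Real.log v with hl
  have hl0 : 0 ≤ l := by have := Real.log_nonpos hv0.le hv1; linarith
  have hlL : l ≤ L := by
    have h1 : Real.log (1 / L) ≤ Real.log v := Real.log_le_log (by positivity) hv
    rw [one_div, Real.log_inv] at h1
    have := Real.log_le_sub_one_of_pos hL0
    linarith
  have hl1 : 1 - v ≤ l := by have := Real.log_le_sub_one_of_pos hv0; linarith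
  have hl2 : l ≤ L * (1 - v) := by
    have h1 := Real.one_sub_inv_le_log_of_pos hv0
    have h2 : v⁻¹ ≤ L := by
      rw [inv_le_comm₀ hv0 hL0, ← one_div]; exact hv
    have h3 : v⁻¹ - 1 = v⁻¹ * (1 - v) := by field_simp
    nlinarith
  have hlu0 : 0 ≤ Real.log u := Real.log_nonneg hu
  have hlu1 : Real.log u ≤ u - 1 := Real.log_le_sub_one_of_pos hu0
  have hlu2 : u - 1 ≤ u * Real.log u := by
    have h1 := mul_le_mul_of_nonneg_left (Real.one_sub_inv_le_log_of_pos hu0) hu0.le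
    rwa [mul_sub, mul_inv_cancel₀ hu0.ne', mul_one] at h1
  have key : (u - 1) * l ≤ 2 * L * ((u - 1) * Real.log u + (1 - v) * l) := by
    rcases le_or_gt u 2 with h2 | h2
    · have h3 : (u - 1) / 2 ≤ Real.log u := by nlinarith
      have h4 : (u - 1) * (u - 1) ≤ L * (2 * ((u - 1) * Real.log u)) := by
        have : (u - 1) * (u - 1) ≤ 2 * ((u - 1) * Real.log u) := by nlinarith
        have h5 : 0 ≤ 2 * ((u - 1) * Real.log u) := by
          have := sub_nonneg.2 hu; positivity
        nlinarith
      have h5 : l * l ≤ L * ((1 - v) * l) := by nlinarith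
      nlinarith [sq_nonneg (u - 1 - l)]
    · have h3 : 1 / 2 ≤ Real.log u := by
        have := Real.log_le_log (by norm_num) h2.le
        have := Real.log_two_gt_d9
        linarith
      have h4 : 0 ≤ (1 - v) * l := mul_nonneg (by linarith) hl0
      have h5 : (u - 1) * l ≤ (u - 1) * L := by gcongr
      have h6 : (u - 1) * L * (1 / 2) ≤ (u - 1) * L * Real.log u := by
        gcongr
      nlinarith
  have h7 : (1 - v) * Real.log u ≤ (u - 1) * l := by
    rw [mul_comm]
    exact mul_le_mul hlu1 hl1 (by linarith) (by linarith)
  have h8 : 0 ≤ (u - 1) * Real.log u + (1 - v) * l :=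
    add_nonneg (mul_nonneg (by linarith) hlu0) (mul_nonneg (by linarith) hl0)
  unfold logDiff
  simp only [Real.log_one, sub_zero]
  have h9 : (u - v) * (Real.log u - Real.log v) =
    ((u - 1) * Real.log u + (1 - v) * l) + (u - 1) * l + (1 - v) * Real.log u := by
    rw [hl]; ring
  have h10 : (u - 1) * Real.log u + (v - 1) * Real.log v =
    (u - 1) * Real.log u + (1 - v) * l := by rw [hl]; ring
  rw [h9, h10]
  nlinarith

/-- A quasi-triangle inequality through `F` for numbers that are not much smaller than `F`. -/
lemma logDiff_le_through {a b F L : ℝ} (hL : 1 ≤ L) (hF : 0 < F) (ha : F ≤ L * a)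
    (hb : F ≤ L * b) : logDiff a b ≤ 5 * L * (logDiff a F + logDiff b F) := by
  have hL0 : 0 < L := by linarith
  have ha0 : 0 < a := pos_of_mul_pos_right (hF.trans_le ha) hL0.le
  have hb0 : 0 < b := pos_of_mul_pos_right (hF.trans_le hb) hL0.le
  -- When F lies between the two numbers, homogeneity reduces to F = 1. When both are on the same
  -- side of F, monotonicity suffices.
  have h1 : ∀ {u v : ℝ}, F ≤ u → v ≤ F → F ≤ L * v →
      logDiff u v ≤ 5 * L * (logDiff u F + logDiff v F) := by
    intro u v hu hv hv'
    have hv0 : 0 < v := pos_of_mul_pos_right (hF.trans_le hv') hL0.le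
    have h2 := logDiff_le_through_one (u := u / F) (v := v / F) hL ((one_le_div hF).2 hu)
      (by rw [div_le_div_iff₀ hL0 hF]; linarith) ((div_le_one hF).2 hv)
    have h3 := mul_le_mul_of_nonneg_left h2 hF.le
    have hu0 : 0 < u := hF.trans_le hu
    rw [← logDiff_mul hF (by positivity) (by positivity), mul_left_comm, mul_add,
      ← logDiff_mul hF (by positivity) one_pos, ← logDiff_mul hF (by positivity) one_pos,
      mul_div_cancel₀ _ hF.ne', mul_div_cancel₀ _ hF.ne', mul_one] at h3
    exact h3
  have hna := logDiff_nonneg ha0 hF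
  have hnb := logDiff_nonneg hb0 hF
  have h5 : logDiff a F + logDiff b F ≤ 5 * L * (logDiff a F + logDiff b F) := by nlinarith
  have h6 : ∀ {u v : ℝ}, F ≤ v → v ≤ u → logDiff u v ≤ logDiff u F :=
    fun h h' => logDiff_mono hF h h'
  have h7 : ∀ {u v : ℝ}, 0 < v → v ≤ u → u ≤ F → logDiff u v ≤ logDiff v F := by
    intro u v hv hvu huF
    have h1 := Real.log_le_log hv hvu
    have h2 := Real.log_le_log (hv.trans_le hvu) huF
    unfold logDiff
    rw [← neg_mul_neg (v - F)]
    apply mul_le_mul <;> linarith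
  rcases le_total a F with haF | haF <;> rcases le_total b F with hbF | hbF
  · rcases le_total a b with hab | hab
    · rw [logDiff_comm a b]; have := h7 ha0 hab hbF; linarith
    · have := h7 hb0 hab haF; linarith
  · rw [logDiff_comm, add_comm]; exact h1 hbF haF ha
  · exact h1 haF hbF hb
  · rcases le_total a b with hab | hab
    · rw [logDiff_comm a b]; have := h6 haF hab; linarith
    · have := h6 hbF hab; linarith

end GlauberMixture

/-! ### Peeling the exponential of `klFun` by its Legendre dual -/

namespace GlauberMixture

open InformationTheory

lemma klFun_mono_of_one_le {u v : ℝ} (hu : 1 ≤ u) (huv : u ≤ v) : klFun u ≤ klFun v := by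
  have h1 := Real.log_le_log (by linarith) huv
  have h2 := Real.one_sub_inv_le_log_of_pos (show (0 : ℝ) < v / u from div_pos (by linarith) (by linarith))
  rw [Real.log_div (by linarith) (by linarith)] at h2
  have h3 : 0 ≤ Real.log u := Real.log_nonneg hu
  have h4 := mul_le_mul_of_nonneg_left h2 (show 0 ≤ v by linarith)
  rw [inv_div, mul_sub, mul_div_cancel₀ _ (show v ≠ 0 by linarith)] at h4
  rw [klFun_apply, klFun_apply]
  nlinarith

lemma klFun_anti_of_le_one {u v : ℝ} (hu : 0 ≤ u) (huv : u ≤ v) (hv : v ≤ 1) :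
    klFun v ≤ klFun u := by
  have hcv := convexOn_klFun
  rcases hv.eq_or_lt with rfl | hv
  · rw [klFun_one]; exact klFun_nonneg hu
  have hu1 : 0 < 1 - u := by linarith
  have h := hcv.2 hu (show (1 : ℝ) ∈ Set.Ici 0 by simp)
    (show 0 ≤ (1 - v) / (1 - u) from div_nonneg (by linarith) hu1.le)
    (show 0 ≤ (v - u) / (1 - u) from div_nonneg (by linarith) hu1.le)
    (by field_simp; ring)
  simp only [smul_eq_mul, klFun_one, mul_zero, add_zero] at h
  have h2 : (1 - v) / (1 - u) * u + (v - u) / (1 - u) * 1 = v := by field_simp; ring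
  rw [h2] at h
  refine h.trans (mul_le_of_le_one_left (klFun_nonneg hu) ((div_le_one hu1).2 (by linarith)))

/-- A single exponent witnesses the Legendre dual lower bound `j` at all points above `1` where
`θ * klFun` exceeds `j`. -/
lemma exists_exponent_above {θ : ℝ} (hθ : 0 ≤ θ) (j : ℕ) :
    ∃ g : ℝ, ∀ u, 1 ≤ u → ((j : ℝ) < θ * klFun u ∨ j = 0) →
      (j : ℝ) ≤ θ * (u * g - (Real.exp g - 1)) := by
  rcases eq_or_ne j 0 with rfl | hj
  · exact ⟨0, fun u _ _ => by simp⟩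
  by_cases h : ∃ u, 1 ≤ u ∧ (j : ℝ) < θ * klFun u
  · obtain ⟨w, hw, hjw⟩ := h
    have hc : ContinuousOn (fun u => θ * klFun u) (Set.Icc 1 w) :=
      (continuous_const.mul continuous_klFun).continuousOn
    obtain ⟨v, ⟨hv1, -⟩, hv⟩ := intermediate_value_Icc hw hc
      (show (j : ℝ) ∈ Set.Icc _ _ from ⟨by simp [klFun_one], hjw.le⟩)
    -- With g = log v, the affine function u g - (e^g - 1) is the tangent to `klFun` at v. It equals
    -- j/θ there and increases to the right of v, as v ≥ 1.
    refine ⟨Real.log v, fun u hu hju => ?_⟩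
    have hju := hju.resolve_right hj
    have hvu : v ≤ u := by
      by_contra! hlt
      have := mul_le_mul_of_nonneg_left (klFun_mono_of_one_le hu hlt.le) hθ
      simp only at hv
      linarith
    rw [Real.exp_log (by linarith)]
    have h0 := Real.log_nonneg hv1
    calc (j : ℝ) = θ * klFun v := hv.symm
      _ ≤ _ := by
        refine mul_le_mul_of_nonneg_left ?_ hθ
        rw [klFun_apply]
        nlinarith
  · push Not at h
    exact ⟨0, fun u hu hju => absurd (hju.resolve_right hj) (h u hu).not_gt⟩

lemma exists_exponent_below {θ : ℝ} (hθ : 0 ≤ θ) (j : ℕ) :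
    ∃ g : ℝ, ∀ u, 0 ≤ u → u ≤ 1 → ((j : ℝ) < θ * klFun u ∨ j = 0) →
      (j : ℝ) ≤ θ * (u * g - (Real.exp g - 1)) := by
  rcases eq_or_ne j 0 with rfl | hj
  · exact ⟨0, fun u _ _ _ => by simp⟩
  by_cases h : ∃ u, 0 ≤ u ∧ u ≤ 1 ∧ (j : ℝ) < θ * klFun u
  · obtain ⟨w, hw0, hw, hjw⟩ := h
    have hc : ContinuousOn (fun u => θ * klFun u) (Set.Icc w 1) :=
      (continuous_const.mul continuous_klFun).continuousOn
    obtain ⟨v, ⟨hwv, hv1⟩, hv⟩ := intermediate_value_Icc' hw hc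
      (show (j : ℝ) ∈ Set.Icc _ _ from ⟨by simp [klFun_one], hjw.le⟩)
    simp only at hv
    -- The slope log v needs v > 0: if v = 0 then w = 0 too, but θ * `klFun` equals j at v and
    -- exceeds j at w.
    have hv0 : 0 < v := by
      refine (hw0.trans hwv).lt_of_ne ?_
      rintro rfl
      rw [le_antisymm hwv hw0] at hjw
      linarith
    refine ⟨Real.log v, fun u hu0 hu hju => ?_⟩
    have hju := hju.resolve_right hj
    have hvu : u ≤ v := by
      by_contra! hlt
      have := mul_le_mul_of_nonneg_left (klFun_anti_of_le_one hv0.le hlt.le hu) hθ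
      linarith
    rw [Real.exp_log hv0]
    have h0 := Real.log_nonpos hv0.le hv1
    calc (j : ℝ) = θ * klFun v := hv.symm
      _ ≤ _ := by
        refine mul_le_mul_of_nonneg_left ?_ hθ
        rw [klFun_apply]
        nlinarith
  · push Not at h
    exact ⟨0, fun u hu0 hu hju => absurd (hju.resolve_right hj) (h u hu0 hu).not_gt⟩

/-- The weights of the finite family of exponents in `exists_exp_klFun_le_sum`. -/
noncomputable def peelWeight (i : ℕ × Bool) : ℝ := Real.exp ((1 - i.1) / 2)

/-- Two geometric series of ratio e^{-1/2} and first term e^{1/2}; their sum is below 10 < e³. -/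
lemma sum_peelWeight_le (N : ℕ) :
    ∑ i ∈ Finset.range N ×ˢ Finset.univ, peelWeight i ≤ Real.exp 3 := by
  set r := Real.exp (1 / 2) with hr
  have hr0 : 0 < r := Real.exp_pos _
  have hr2 : r ^ 2 = Real.exp 1 := by rw [hr, ← Real.exp_nat_mul]; norm_num
  have he := Real.exp_one_gt_d9
  have he' := Real.exp_one_lt_d9
  have hr3 : 1.6 < r := by nlinarith
  have hr4 : r < 1.7 := by nlinarith
  have hw : ∀ j : ℕ, Real.exp ((1 - (j : ℝ)) / 2) = r * (r⁻¹) ^ j := by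
    intro j
    rw [hr, ← Real.exp_neg, ← Real.exp_nat_mul, ← Real.exp_add]
    congr 1
    ring
  have hlt : r⁻¹ < 1 := inv_lt_one_of_one_lt₀ (by linarith)
  have hgeom : ∑ j ∈ Finset.range N, (r⁻¹) ^ j ≤ (1 - r⁻¹)⁻¹ := by
    rw [← tsum_geometric_of_lt_one (by positivity) hlt]
    exact (summable_geometric_of_lt_one (by positivity) hlt).sum_le_tsum _
      (fun _ _ => by positivity)
  have hb : (1 - r⁻¹)⁻¹ ≤ 8 / 3 := by
    rw [inv_le_comm₀ (by linarith) (by norm_num)]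
    have : r⁻¹ ≤ 5 / 8 := by
      rw [inv_le_comm₀ hr0 (by norm_num)]; norm_num; linarith
    norm_num
    linarith
  have h3 : 10 ≤ Real.exp 3 := by
    have : Real.exp 3 = Real.exp 1 ^ 3 := by rw [← Real.exp_nat_mul]; norm_num
    rw [this]
    nlinarith [sq_nonneg (Real.exp 1 - 2.7)]
  calc ∑ i ∈ Finset.range N ×ˢ Finset.univ, peelWeight i
      = 2 * (r * ∑ j ∈ Finset.range N, (r⁻¹) ^ j) := by
        rw [Finset.sum_product, Finset.mul_sum, Finset.mul_sum]
        refine Finset.sum_congr rfl fun j _ => ?_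
        simp only [peelWeight, hw, Fintype.sum_bool]
        ring
    _ ≤ 2 * (1.7 * (8 / 3)) := by gcongr; exact hgeom.trans hb
    _ ≤ Real.exp 3 := by norm_num; linarith

/-- The exponential of half of `θ * klFun u` is dominated by a mixture, with total mass bounded
independently of `θ`, of exponentials of affine functions of `u` that lie below `θ * klFun`. -/
lemma exists_exp_klFun_le_sum {θ : ℝ} (hθ : 0 ≤ θ) (N : ℕ) :
    ∃ g : ℕ × Bool → ℝ, ∀ u, 0 ≤ u → θ * klFun u ≤ N →
      Real.exp (θ * klFun u / 2) ≤ ∑ i ∈ Finset.range (N + 1) ×ˢ Finset.univ,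
        peelWeight i * Real.exp (θ * (u * g i - (Real.exp (g i) - 1))) := by
  choose ga hga using exists_exponent_above hθ
  choose gb hgb using exists_exponent_below hθ
  refine ⟨fun i => if i.2 then ga i.1 else gb i.1, fun u hu hN => ?_⟩
  -- The level j is chosen with j < θ klFun u ≤ j + 1. The term of level j alone suffices, since
  -- e^{(1-j)/2} e^j = e^{(j+1)/2}.
  obtain ⟨j, hjN, hj, hj1⟩ : ∃ j : ℕ, j < N + 1 ∧ ((j : ℝ) < θ * klFun u ∨ j = 0) ∧
      θ * klFun u ≤ j + 1 := by
    rcases le_or_gt (θ * klFun u) 0 with h0 | h0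
    · exact ⟨0, by omega, Or.inr rfl, by push_cast; linarith⟩
    · have h1 : 0 < ⌈θ * klFun u⌉₊ := Nat.ceil_pos.2 h0
      have h2 : ⌈θ * klFun u⌉₊ ≤ N := Nat.ceil_le.2 hN
      refine ⟨⌈θ * klFun u⌉₊ - 1, by omega, Or.inl ?_, ?_⟩
      · exact Nat.lt_ceil.1 (by omega)
      · rw [Nat.cast_pred h1, sub_add_cancel]
        exact Nat.le_ceil _
  have hmain : ∀ (b : Bool) (g : ℝ), (if b then ga j else gb j) = g →
      (j : ℝ) ≤ θ * (u * g - (Real.exp g - 1)) → Real.exp (θ * klFun u / 2) ≤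
      ∑ i ∈ Finset.range (N + 1) ×ˢ Finset.univ, peelWeight i *
        Real.exp (θ * (u * (if i.2 then ga i.1 else gb i.1) -
          (Real.exp (if i.2 then ga i.1 else gb i.1) - 1))) := by
    intro b g hg hjg
    refine le_trans ?_ (Finset.single_le_sum (a := (j, b)) (fun i _ => ?_) (by simpa using hjN))
    · simp only [hg, peelWeight]
      rw [← Real.exp_add]
      exact Real.exp_le_exp.2 (by linarith)
    · unfold peelWeight
      positivity
  rcases le_total 1 u with h | h
  · exact hmain true _ rfl (hga j u h hj)
  · exact hmain false _ rfl (hgb j u hu h hj)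

end GlauberMixture

/-! ### Reversible chains: semigroup, resolvent and entropy dissipation -/

namespace GlauberMixture

open InformationTheory Matrix NormedSpace

section DetailedBalance

variable {Ω : Type*} [Fintype Ω]

/-- Detailed balance of the transition matrix `P` with respect to `μ`. -/
def DetailedBalance {Ω : Type*} (μ : Ω → ℝ) (P : Matrix Ω Ω ℝ) : Prop :=
  ∀ x y, μ x * P x y = μ y * P y x

lemma DetailedBalance.vecMul_mul {μ : Ω → ℝ} {P : Matrix Ω Ω ℝ} (h : DetailedBalance μ P)
    (f : Ω → ℝ) : (fun x => μ x * f x) ᵥ* P = fun x => μ x * (P *ᵥ f) x := by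
  ext y
  simp only [vecMul, mulVec, dotProduct, Finset.mul_sum]
  refine Finset.sum_congr rfl fun x _ => ?_
  rw [mul_right_comm, h, mul_assoc]

end DetailedBalance

section Chain

variable {Ω : Type*} [Fintype Ω] [DecidableEq Ω]

open scoped Matrix.Norms.Operator in
lemma hasSum_exp_matrix (A : Matrix Ω Ω ℝ) :
    HasSum (fun k : ℕ => ((k.factorial : ℝ)⁻¹) • A ^ k) (exp A) :=
  exp_series_hasSum_exp' (𝕂 := ℝ) A

open scoped Matrix.Norms.Operator in
lemma hasDerivAt_exp_smul_matrix (A : Matrix Ω Ω ℝ) (t : ℝ) :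
    HasDerivAt (fun u : ℝ => exp (u • A)) (A * exp (t • A)) t :=
  hasDerivAt_exp_smul_const' A t

/-- An intertwining relation passes to matrix exponentials. -/
lemma mul_exp_eq_exp_mul {Ω' : Type*} [Fintype Ω'] [DecidableEq Ω'] {A : Matrix Ω Ω ℝ}
    {B : Matrix Ω' Ω' ℝ} {X : Matrix Ω' Ω ℝ} (h : X * A = B * X) : X * exp A = exp B * X := by
  have hp : ∀ k : ℕ, X * A ^ k = B ^ k * X := by
    intro k
    induction k with
    | zero => simp
    | succ k ih => rw [pow_succ, pow_succ, ← Matrix.mul_assoc, ih, Matrix.mul_assoc, h,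
        Matrix.mul_assoc]
  have hA := (hasSum_exp_matrix A).map (⟨⟨fun M => X * M, Matrix.mul_zero X⟩, Matrix.mul_add X⟩ :
    Matrix Ω Ω ℝ →+ Matrix Ω' Ω ℝ) (continuous_const.matrix_mul continuous_id)
  have hB := (hasSum_exp_matrix B).map (⟨⟨fun M => M * X, Matrix.zero_mul X⟩,
    fun M N => Matrix.add_mul M N X⟩ : Matrix Ω' Ω' ℝ →+ Matrix Ω' Ω ℝ)
    (continuous_id.matrix_mul continuous_const)
  refine hA.unique (hB.congr_fun fun k => ?_)
  simp [hp]

lemma exp_mulVec_of_mulVec_eq_zero {A : Matrix Ω Ω ℝ} {v : Ω → ℝ} (h : A *ᵥ v = 0) :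
    exp A *ᵥ v = v := by
  have h1 : replicateCol Unit v * (0 : Matrix Unit Unit ℝ) = A * replicateCol Unit v := by
    rw [← replicateCol_mulVec, h]
    simp
  have h2 := mul_exp_eq_exp_mul h1
  rw [exp_zero, Matrix.mul_one, ← replicateCol_mulVec] at h2
  exact (replicateCol_injective h2).symm

lemma exp_apply_nonneg {A : Matrix Ω Ω ℝ} (h : ∀ x y, 0 ≤ A x y) (x y : Ω) : 0 ≤ exp A x y := by
  have hp : ∀ (k : ℕ) (x y : Ω), 0 ≤ (A ^ k) x y := by
    intro k
    induction k with
    | zero => intro x y; rw [pow_zero, one_apply]; split_ifs <;> norm_num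
    | succ k ih =>
      intro x y
      rw [pow_succ, Matrix.mul_apply]
      exact Finset.sum_nonneg fun z _ => mul_nonneg (ih x z) (h z y)
  refine (Pi.hasSum.1 (Pi.hasSum.1 (hasSum_exp_matrix A) x) y).nonneg fun k => ?_
  exact mul_nonneg (by positivity) (hp k x y)

lemma exp_generator_mem_rowStochastic {P : Matrix Ω Ω ℝ} (hP : P ∈ rowStochastic ℝ Ω) {t : ℝ}
    (ht : 0 ≤ t) : exp (t • (P - 1)) ∈ rowStochastic ℝ Ω := by
  refine ⟨fun x y => ?_, exp_mulVec_of_mulVec_eq_zero ?_⟩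
  -- Nonnegativity of the entries comes from the factorization e^{t(P - 1)} = e^{tP} e^{-t}.
  · have h1 : t • (P - 1) = t • P + diagonal fun _ => -t := by
      ext x y
      by_cases h : x = y
      · subst h; simp; ring
      · simp [h]
    have hc : Commute (t • P) (diagonal fun _ : Ω => -t) := by
      rw [show (diagonal fun _ : Ω => -t) = (-t) • (1 : Matrix Ω Ω ℝ) by
        rw [smul_one_eq_diagonal]]
      exact (Commute.one_right _).smul_right _
    rw [h1, exp_add_of_commute _ _ hc, exp_diagonal, mul_diagonal]
    refine mul_nonneg (exp_apply_nonneg (fun x y => ?_) x y) ?_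
    · exact mul_nonneg ht (hP.1 x y)
    · rw [Pi.coe_exp, ← Real.exp_eq_exp_ℝ]
      positivity
  · rw [smul_mulVec, sub_mulVec, hP.2, one_mulVec, sub_self, smul_zero]

lemma detailedBalance_iff {μ : Ω → ℝ} {P : Matrix Ω Ω ℝ} :
    DetailedBalance μ P ↔ diagonal μ * P = Pᵀ * diagonal μ := by
  rw [← Matrix.ext_iff]
  simp only [DetailedBalance, diagonal_mul, mul_diagonal, transpose_apply, mul_comm (P _ _)]

lemma DetailedBalance.exp_generator {μ : Ω → ℝ} {P : Matrix Ω Ω ℝ} (h : DetailedBalance μ P)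
    (t : ℝ) : DetailedBalance μ (exp (t • (P - 1))) := by
  rw [detailedBalance_iff, ← exp_transpose]
  apply mul_exp_eq_exp_mul
  rw [detailedBalance_iff] at h
  simp only [transpose_smul, transpose_sub, transpose_one, Matrix.mul_smul, Matrix.smul_mul,
    Matrix.mul_sub, Matrix.sub_mul, h, Matrix.mul_one, Matrix.one_mul]

lemma DetailedBalance.vecMul_eq {μ : Ω → ℝ} {P : Matrix Ω Ω ℝ} (h : DetailedBalance μ P)
    (hP : P ∈ rowStochastic ℝ Ω) : μ ᵥ* P = μ := by
  have := h.vecMul_mul 1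
  rw [hP.2] at this
  simpa using this

/-! ### The resolvent `(2 - P)⁻¹` -/

/-- The resolvent `(2 - P)⁻¹`, that is `∑ s, 2^{-s-1} P^s`. -/
noncomputable def resolvent (P : Matrix Ω Ω ℝ) : Matrix Ω Ω ℝ := ((2 : ℝ) • 1 - P)⁻¹

/-- Minimum principle: at a minimum z of g, (P g)(z) ≥ g(z), so 0 ≤ 2 g(z) - (P g)(z) ≤ g(z). It
yields both the invertibility of 2 - P and the positivity of its inverse. -/
lemma nonneg_of_two_smul_sub_mulVec_nonneg {P : Matrix Ω Ω ℝ} (hP : P ∈ rowStochastic ℝ Ω)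
    {g : Ω → ℝ} (h : ∀ x, 0 ≤ (((2 : ℝ) • 1 - P) *ᵥ g) x) (x : Ω) : 0 ≤ g x := by
  have : Nonempty Ω := ⟨x⟩
  obtain ⟨z, hz⟩ := Finite.exists_min g
  have h1 : g z ≤ (P *ᵥ g) z := by
    calc g z = ∑ y, P z y * g z := by
          rw [← Finset.sum_mul, sum_row_of_mem_rowStochastic hP, one_mul]
      _ ≤ ∑ y, P z y * g y :=
          Finset.sum_le_sum fun y _ => mul_le_mul_of_nonneg_left (hz y) (hP.1 z y)
  have h2 := h z
  rw [sub_mulVec, smul_mulVec, one_mulVec] at h2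
  simp only [Pi.sub_apply, Pi.smul_apply, smul_eq_mul] at h2
  linarith [hz x]

lemma isUnit_two_smul_sub {P : Matrix Ω Ω ℝ} (hP : P ∈ rowStochastic ℝ Ω) :
    IsUnit ((2 : ℝ) • 1 - P) := by
  rw [← mulVec_injective_iff_isUnit]
  intro f g hfg
  have h0 : ((2 : ℝ) • 1 - P) *ᵥ (f - g) = 0 := by
    rw [mulVec_sub, sub_eq_zero]; exact hfg
  have h1 : ((2 : ℝ) • 1 - P) *ᵥ (g - f) = 0 := by
    rw [mulVec_sub, sub_eq_zero]; exact hfg.symm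
  ext x
  have h2 := nonneg_of_two_smul_sub_mulVec_nonneg hP (g := f - g) (by simp [h0]) x
  have h3 := nonneg_of_two_smul_sub_mulVec_nonneg hP (g := g - f) (by simp [h1]) x
  simp only [Pi.sub_apply] at h2 h3
  linarith

lemma two_smul_sub_mul_resolvent {P : Matrix Ω Ω ℝ} (hP : P ∈ rowStochastic ℝ Ω) :
    ((2 : ℝ) • 1 - P) * resolvent P = 1 :=
  mul_nonsing_inv _ ((isUnit_iff_isUnit_det _).1 (isUnit_two_smul_sub hP))

lemma resolvent_mul_two_smul_sub {P : Matrix Ω Ω ℝ} (hP : P ∈ rowStochastic ℝ Ω) :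
    resolvent P * ((2 : ℝ) • 1 - P) = 1 :=
  nonsing_inv_mul _ ((isUnit_iff_isUnit_det _).1 (isUnit_two_smul_sub hP))

lemma resolvent_mem_rowStochastic {P : Matrix Ω Ω ℝ} (hP : P ∈ rowStochastic ℝ Ω) :
    resolvent P ∈ rowStochastic ℝ Ω := by
  refine ⟨fun x y => ?_, ?_⟩
  · have h := nonneg_of_two_smul_sub_mulVec_nonneg hP (g := resolvent P *ᵥ Pi.single y 1)
      (fun z => by
        rw [mulVec_mulVec, two_smul_sub_mul_resolvent hP, one_mulVec]
        by_cases hz : z = y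
        · subst hz; simp
        · simp [hz]) x
    simpa using h
  · have h : ((2 : ℝ) • 1 - P) *ᵥ 1 = 1 := by
      rw [sub_mulVec, hP.2, smul_mulVec, one_mulVec, two_smul, add_sub_cancel_right]
    nth_rw 1 [← h]
    rw [mulVec_mulVec, resolvent_mul_two_smul_sub hP, one_mulVec]

lemma vecMul_resolvent {P : Matrix Ω Ω ℝ} (hP : P ∈ rowStochastic ℝ Ω) {μ : Ω → ℝ}
    (hμ : μ ᵥ* P = μ) : μ ᵥ* resolvent P = μ := by
  have h : μ ᵥ* ((2 : ℝ) • 1 - P) = μ := by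
    rw [vecMul_sub, hμ, vecMul_smul, vecMul_one, two_smul, add_sub_cancel_right]
  nth_rw 1 [← h]
  rw [vecMul_vecMul, two_smul_sub_mul_resolvent hP, vecMul_one]

/-! ### Entropy along the chain -/

/-- Entropy contracts under stochastic matrices with stationary distribution `μ`. -/
lemma sum_klFun_mulVec_le {μ : Ω → ℝ} (hμ : ∀ x, 0 ≤ μ x) {K : Matrix Ω Ω ℝ}
    (hK : K ∈ rowStochastic ℝ Ω) (hμK : μ ᵥ* K = μ) {f : Ω → ℝ} (hf : ∀ x, 0 ≤ f x) :
    ∑ x, μ x * klFun ((K *ᵥ f) x) ≤ ∑ x, μ x * klFun (f x) := by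
  have h1 : ∀ x, klFun ((K *ᵥ f) x) ≤ ∑ y, K x y * klFun (f y) := fun x =>
    convexOn_klFun.map_sum_le (fun y _ => hK.1 x y) (sum_row_of_mem_rowStochastic hK x)
      (fun y _ => hf y)
  calc ∑ x, μ x * klFun ((K *ᵥ f) x) ≤ ∑ x, μ x * (K *ᵥ fun y => klFun (f y)) x :=
        Finset.sum_le_sum fun x _ => mul_le_mul_of_nonneg_left (h1 x) (hμ x)
    _ = (μ ᵥ* K) ⬝ᵥ fun y => klFun (f y) := by rw [← dotProduct_mulVec]; rfl
    _ = _ := by rw [hμK]; rfl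

lemma dirichletForm_eq {μ : Ω → ℝ} {P : Matrix Ω Ω ℝ} (hP : P ∈ rowStochastic ℝ Ω)
    (h : DetailedBalance μ P) (f g : Ω → ℝ) :
    dirichletForm μ P f g = 2 * ∑ x, μ x * ((f x - (P *ᵥ f) x) * g x) := by
  have hrow := sum_row_of_mem_rowStochastic hP
  have h1 : ∑ x, ∑ y, μ x * P x y * (f x * g x) = ∑ x, μ x * (f x * g x) := by
    refine Finset.sum_congr rfl fun x _ => ?_
    rw [← Finset.sum_mul, ← Finset.mul_sum, hrow, mul_one]
  have h2 : ∑ x, ∑ y, μ x * P x y * (f y * g y) = ∑ x, μ x * (f x * g x) := by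
    rw [Finset.sum_comm, ← h1]
    simp only [h _ _]
  have h3 : ∑ x, ∑ y, μ x * P x y * (f y * g x) = ∑ x, μ x * ((P *ᵥ f) x * g x) := by
    refine Finset.sum_congr rfl fun x _ => ?_
    simp only [mulVec, dotProduct, Finset.mul_sum, Finset.sum_mul]
    refine Finset.sum_congr rfl fun y _ => by ring
  have h4 : ∑ x, ∑ y, μ x * P x y * (f x * g y) = ∑ x, μ x * ((P *ᵥ f) x * g x) := by
    rw [Finset.sum_comm, ← h3]
    simp only [h _ _]
  calc dirichletForm μ P f g = ∑ x, ∑ y, (μ x * P x y * (f x * g x) + μ x * P x y * (f y * g y)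
        - μ x * P x y * (f y * g x) - μ x * P x y * (f x * g y)) := by
        unfold dirichletForm
        refine Finset.sum_congr rfl fun x _ => Finset.sum_congr rfl fun y _ => by ring
    _ = _ := by
        simp only [Finset.sum_add_distrib, Finset.sum_sub_distrib, h1, h2, h3, h4, sub_mul, mul_sub]
        ring

lemma hasDerivAt_exp_generator_mulVec (P : Matrix Ω Ω ℝ) (g : Ω → ℝ) (t : ℝ) (x : Ω) :
    HasDerivAt (fun s : ℝ => (exp (s • (P - 1)) *ᵥ g) x)
      ((P *ᵥ (exp (t • (P - 1)) *ᵥ g)) x - (exp (t • (P - 1)) *ᵥ g) x) t := by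
  have h1 := hasDerivAt_exp_smul_matrix (P - 1) t
  have h2 : HasDerivAt (fun s : ℝ => ∑ y, exp (s • (P - 1)) x y * g y)
      (∑ y, ((P - 1) * exp (t • (P - 1))) x y * g y) t := by
    refine HasDerivAt.fun_sum fun y _ => ?_
    exact ((hasDerivAt_pi.1 ((hasDerivAt_pi.1 h1) x)) y).mul_const (g y)
  have h3 : (P *ᵥ (exp (t • (P - 1)) *ᵥ g)) x - (exp (t • (P - 1)) *ᵥ g) x =
      (((P - 1) * exp (t • (P - 1))) *ᵥ g) x := by
    rw [← mulVec_mulVec, sub_mulVec, one_mulVec, Pi.sub_apply]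
  rw [h3]
  exact h2

/-- The entropy dissipation identity. -/
lemma hasDerivAt_sum_klFun {μ : Ω → ℝ} {P : Matrix Ω Ω ℝ} (hP : P ∈ rowStochastic ℝ Ω)
    (h : DetailedBalance μ P) (g : Ω → ℝ) (t : ℝ)
    (hpos : ∀ x, (exp (t • (P - 1)) *ᵥ g) x ≠ 0) :
    HasDerivAt (fun s : ℝ => ∑ x, μ x * klFun ((exp (s • (P - 1)) *ᵥ g) x))
      (-(1 / 2) * dirichletForm μ P (exp (t • (P - 1)) *ᵥ g)
        (fun x => Real.log ((exp (t • (P - 1)) *ᵥ g) x))) t := by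
  rw [dirichletForm_eq hP h]
  have h2 : HasDerivAt (fun s : ℝ => ∑ x, μ x * klFun ((exp (s • (P - 1)) *ᵥ g) x))
      (∑ x, μ x * (Real.log ((exp (t • (P - 1)) *ᵥ g) x) *
        ((P *ᵥ (exp (t • (P - 1)) *ᵥ g)) x - (exp (t • (P - 1)) *ᵥ g) x))) t := by
    refine HasDerivAt.fun_sum fun x _ => HasDerivAt.const_mul _ ?_
    exact (hasDerivAt_klFun (hpos x)).comp t (hasDerivAt_exp_generator_mulVec P g t x)
  convert h2 using 1
  rw [← mul_assoc, Finset.mul_sum]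
  refine Finset.sum_congr rfl fun x _ => by ring

end Chain

end GlauberMixture

/-! ### Glauber dynamics and comparison of Dirichlet forms in a mixture -/

namespace GlauberMixture

open InformationTheory Matrix

section Mixture

variable {Ω ι : Type*} [Fintype Ω] [Fintype ι]

lemma mixture_nonneg {ρ : ι → ℝ} {ν : ι → Ω → ℝ} (hρ : ρ ∈ stdSimplex ℝ ι)
    (hν : ∀ a, ν a ∈ stdSimplex ℝ Ω) (x : Ω) : 0 ≤ mixture ρ ν x :=
  Finset.sum_nonneg fun a _ => mul_nonneg (hρ.1 a) ((hν a).1 x)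

lemma sum_mixture_mul (ρ : ι → ℝ) (ν : ι → Ω → ℝ) (f : Ω → ℝ) :
    ∑ x, mixture ρ ν x * f x = ∑ a, ρ a * ∑ x, ν a x * f x := by
  simp only [mixture, Finset.sum_mul, Finset.mul_sum]
  rw [Finset.sum_comm]
  simp only [mul_assoc]

lemma sum_mixture {ρ : ι → ℝ} {ν : ι → Ω → ℝ} (hρ : ρ ∈ stdSimplex ℝ ι)
    (hν : ∀ a, ν a ∈ stdSimplex ℝ Ω) : ∑ x, mixture ρ ν x = 1 := by
  have := sum_mixture_mul ρ ν fun _ => 1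
  simpa [(hν _).2, hρ.2] using this

end Mixture

lemma update_congr_of_agree {n : ℕ} {S : Type*} {i : Fin n} {x y : Fin n → S} (h : ∀ j, j ≠ i → y j = x j) (s : S) :
    Function.update y i s = Function.update x i s := by
  ext j
  by_cases hj : j = i
  · subst hj; simp
  · simp [hj, h j hj]

section LineMass

variable {n : ℕ} {S : Type*} [Fintype S]

lemma lineMass_congr (μ : (Fin n → S) → ℝ) {i : Fin n} {x y : Fin n → S}
    (h : ∀ j, j ≠ i → y j = x j) : lineMass μ i y = lineMass μ i x := by
  unfold lineMass
  simp only [update_congr_of_agree h]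

lemma le_lineMass {μ : (Fin n → S) → ℝ} (hμ : ∀ x, 0 ≤ μ x) (i : Fin n) (x : Fin n → S) :
    μ x ≤ lineMass μ i x := by
  have := Finset.single_le_sum (f := fun s => μ (Function.update x i s)) (fun s _ => hμ _)
    (Finset.mem_univ (x i))
  rwa [Function.update_eq_self] at this

lemma lineMass_nonneg {μ : (Fin n → S) → ℝ} (hμ : ∀ x, 0 ≤ μ x) (i : Fin n) (x : Fin n → S) :
    0 ≤ lineMass μ i x := (hμ x).trans (le_lineMass hμ i x)

end LineMass

section Glauber

variable {n : ℕ} {S : Type*} [Fintype S] [DecidableEq S]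

lemma sum_agree (i : Fin n) (x : Fin n → S) (h : (Fin n → S) → ℝ) :
    ∑ y, (if ∀ j, j ≠ i → y j = x j then h y else 0) = ∑ s, h (Function.update x i s) := by
  rw [← Finset.sum_filter]
  symm
  refine Finset.sum_bij (fun s _ => Function.update x i s) ?_ ?_ ?_ ?_
  · intro s _
    simp only [Finset.mem_filter, Finset.mem_univ, true_and]
    intro j hj
    simp [hj]
  · intro s _ s' _ hs
    exact Function.update_injective x i hs
  · intro y hy
    simp only [Finset.mem_filter, Finset.mem_univ, true_and] at hy
    refine ⟨y i, Finset.mem_univ _, ?_⟩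
    rw [← update_congr_of_agree hy]
    simp
  · intro s _
    rfl

lemma resample_mem_rowStochastic {μ : (Fin n → S) → ℝ} (hμ : ∀ x, 0 ≤ μ x) (i : Fin n) :
    resample μ i ∈ rowStochastic ℝ (Fin n → S) := by
  rw [mem_rowStochastic_iff_sum]
  refine ⟨fun x y => ?_, fun x => ?_⟩
  · unfold resample
    split_ifs
    · exact zero_le_one
    · exact le_rfl
    · exact div_nonneg (hμ y) (lineMass_nonneg hμ i x)
    · exact le_rfl
  · unfold resample
    by_cases h : lineMass μ i x = 0
    · simp [h]
    · simp only [h, if_false]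
      rw [sum_agree i x fun y => μ y / lineMass μ i x, ← Finset.sum_div]
      exact div_self h

lemma agree_of_resample_ne_zero {μ : (Fin n → S) → ℝ} {i : Fin n} {x y : Fin n → S}
    (h : resample μ i x y ≠ 0) : ∀ j, j ≠ i → y j = x j := by
  unfold resample at h
  split_ifs at h with h1 h2 h3
  · intro j _; rw [h2]
  · exact absurd rfl h
  · exact h3
  · exact absurd rfl h

lemma resample_row_congr {μ : (Fin n → S) → ℝ} {i : Fin n} {x y : Fin n → S}
    (hx : lineMass μ i x ≠ 0) (h : ∀ j, j ≠ i → y j = x j) : resample μ i y = resample μ i x := by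
  ext z
  unfold resample
  rw [lineMass_congr μ h, if_neg hx, if_neg hx]
  have : (∀ j, j ≠ i → z j = y j) ↔ ∀ j, j ≠ i → z j = x j :=
    forall₂_congr fun j hj => by rw [h j hj]
  simp only [this]

lemma resample_row_congr_of_ne_zero {μ : (Fin n → S) → ℝ} {i : Fin n} {x y : Fin n → S}
    (h : resample μ i x y ≠ 0) : resample μ i y = resample μ i x := by
  by_cases hx : lineMass μ i x = 0
  · have : y = x := by
      by_contra hne
      simp [resample, hx, hne] at h
    rw [this]
  · exact resample_row_congr hx (agree_of_resample_ne_zero h)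

lemma detailedBalance_resample {μ : (Fin n → S) → ℝ} (hμ : ∀ x, 0 ≤ μ x) (i : Fin n) :
    DetailedBalance μ (resample μ i) := by
  intro x y
  by_cases hag : ∀ j, j ≠ i → y j = x j
  · have hl := lineMass_congr μ hag
    have hag' : ∀ j, j ≠ i → x j = y j := fun j hj => (hag j hj).symm
    by_cases h0 : lineMass μ i x = 0
    · have hx : μ x = 0 := le_antisymm (h0 ▸ le_lineMass hμ i x) (hμ x)
      have hy : μ y = 0 := le_antisymm (h0 ▸ hl ▸ le_lineMass hμ i y) (hμ y)
      rw [hx, hy, zero_mul, zero_mul]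
    · unfold resample
      rw [hl, if_neg h0, if_neg h0, if_pos hag, if_pos hag']
      ring
  · have h1 : resample μ i x y = 0 := by
      by_contra h
      exact hag (agree_of_resample_ne_zero h)
    have h2 : resample μ i y x = 0 := by
      by_contra h
      exact hag fun j hj => (agree_of_resample_ne_zero h j hj).symm
    rw [h1, h2, mul_zero, mul_zero]

lemma glauber_apply (μ : (Fin n → S) → ℝ) (x y : Fin n → S) :
    glauber μ x y = (1 / (n : ℝ)) * ∑ i, resample μ i x y := by
  unfold glauber
  rw [Matrix.smul_apply, Matrix.sum_apply, smul_eq_mul]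

lemma glauber_mem_rowStochastic (hn : 1 ≤ n) {μ : (Fin n → S) → ℝ} (hμ : ∀ x, 0 ≤ μ x) :
    glauber μ ∈ rowStochastic ℝ (Fin n → S) := by
  have hn0 : (n : ℝ) ≠ 0 := by positivity
  rw [mem_rowStochastic_iff_sum]
  refine ⟨fun x y => ?_, fun x => ?_⟩
  · rw [glauber_apply]
    exact mul_nonneg (by positivity)
      (Finset.sum_nonneg fun i _ => (resample_mem_rowStochastic hμ i).1 x y)
  · simp only [glauber_apply]
    rw [← Finset.mul_sum, Finset.sum_comm]
    simp only [sum_row_of_mem_rowStochastic (resample_mem_rowStochastic hμ _)]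
    simp [hn0]

lemma detailedBalance_glauber {μ : (Fin n → S) → ℝ} (hμ : ∀ x, 0 ≤ μ x) :
    DetailedBalance μ (glauber μ) := by
  intro x y
  rw [glauber_apply, glauber_apply, mul_left_comm, mul_left_comm (μ y), Finset.mul_sum,
    Finset.mul_sum (a := μ y)]
  simp only [detailedBalance_resample hμ _ x y]

lemma glauber_mulVec (μ f : (Fin n → S) → ℝ) (x : Fin n → S) :
    (glauber μ *ᵥ f) x = (1 / (n : ℝ)) * ∑ i, (resample μ i *ᵥ f) x := by
  simp only [mulVec, dotProduct, glauber_apply]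
  rw [Finset.sum_comm, Finset.mul_sum]
  simp only [Finset.mul_sum, Finset.sum_mul, mul_assoc]

lemma resample_mulVec_le {μ : (Fin n → S) → ℝ} (hμ : ∀ x, 0 ≤ μ x) {f : (Fin n → S) → ℝ}
    (hf : ∀ x, 0 ≤ f x) (i : Fin n) (x : Fin n → S) :
    (resample μ i *ᵥ f) x ≤ n * (glauber μ *ᵥ f) x := by
  have hn0 : (n : ℝ) ≠ 0 := by have := i.pos; positivity
  rw [glauber_mulVec, ← mul_assoc, mul_one_div_cancel hn0, one_mul]
  exact Finset.single_le_sum (f := fun i => (resample μ i *ᵥ f) x)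
    (fun i _ => nonneg_mulVec_of_mem_rowStochastic (resample_mem_rowStochastic hμ i) hf x)
    (Finset.mem_univ i)

lemma dirichletForm_glauber (μ ν f g : (Fin n → S) → ℝ) :
    dirichletForm μ (glauber ν) f g = (1 / (n : ℝ)) * ∑ i, dirichletForm μ (resample ν i) f g := by
  unfold dirichletForm
  simp only [Finset.mul_sum]
  rw [eq_comm, Finset.sum_comm]
  refine Finset.sum_congr rfl fun x _ => ?_
  rw [Finset.sum_comm]
  refine Finset.sum_congr rfl fun y _ => ?_
  rw [glauber_apply, Finset.mul_sum, Finset.mul_sum, Finset.sum_mul]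
  refine Finset.sum_congr rfl fun i _ => by ring

/-- Resampling is a conditional expectation: log F is constant along the lines on which it acts, so
f - F is orthogonal to log F. The resulting sum is linear in the outer weight μ, which lets it split
over the components. -/
lemma dirichletForm_resample_log {μ : (Fin n → S) → ℝ} (hμ : ∀ x, 0 ≤ μ x) (i : Fin n)
    (f : (Fin n → S) → ℝ) :
    dirichletForm μ (resample μ i) f (fun x => Real.log (f x)) =
      2 * ∑ x, μ x * logDiff (f x) ((resample μ i *ᵥ f) x) := by
  have hQ := resample_mem_rowStochastic hμ i
  have hb := detailedBalance_resample hμ i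
  set F := resample μ i *ᵥ f with hF
  have hFQ : (resample μ i *ᵥ fun x => Real.log (F x)) = fun x => Real.log (F x) := by
    ext x
    have : ∀ y, resample μ i x y * Real.log (F y) = resample μ i x y * Real.log (F x) := by
      intro y
      by_cases h : resample μ i x y = 0
      · rw [h, zero_mul, zero_mul]
      · rw [hF]
        simp only [mulVec, resample_row_congr_of_ne_zero h]
    simp only [mulVec, dotProduct, this]
    rw [← Finset.sum_mul, sum_row_of_mem_rowStochastic hQ, one_mul]
  have horth : ∑ x, μ x * ((f x - F x) * Real.log (F x)) = 0 := by
    have h1 : (fun x => μ x * F x) ⬝ᵥ (fun x => Real.log (F x)) =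
        (fun x => μ x * f x) ⬝ᵥ fun x => Real.log (F x) := by
      rw [hF, ← hb.vecMul_mul f, ← dotProduct_mulVec, hFQ]
    simp only [dotProduct] at h1
    simp only [sub_mul, mul_sub, Finset.sum_sub_distrib, ← mul_assoc]
    rw [h1, sub_self]
  rw [dirichletForm_eq hQ hb]
  congr 1
  simp only [logDiff, mul_sub ((_ : ℝ) - _) _ _, mul_sub (μ _), Finset.sum_sub_distrib]
  rw [horth, sub_zero]

/-- The average F is taken under μ, not ν. By absolute continuity it has a common value at the two
ends of every transition charged by ν, through which `logDiff_le_through` is applied; detailed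
balance makes the contributions of the two ends equal. -/
lemma dirichletForm_resample_log_le {μ ν : (Fin n → S) → ℝ} (hμ : ∀ x, 0 ≤ μ x)
    (hν : ∀ x, 0 ≤ ν x) (hac : ∀ x, μ x = 0 → ν x = 0) (i : Fin n) {f : (Fin n → S) → ℝ}
    (hf : ∀ x, 0 < f x) {L : ℝ} (hL : 1 ≤ L) (hfL : ∀ x, (resample μ i *ᵥ f) x ≤ L * f x) :
    dirichletForm ν (resample ν i) f (fun x => Real.log (f x)) ≤
      10 * L * ∑ x, ν x * logDiff (f x) ((resample μ i *ᵥ f) x) := by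
  have hQμ := resample_mem_rowStochastic hμ i
  have hQ := resample_mem_rowStochastic hν i
  have hb := detailedBalance_resample hν i
  set F := resample μ i *ᵥ f with hF
  have hFpos : ∀ x, 0 < F x := by
    intro x
    obtain ⟨y, -, hy⟩ : ∃ y ∈ Finset.univ, 0 < resample μ i x y := by
      apply Finset.exists_lt_of_sum_lt
      simp [sum_row_of_mem_rowStochastic hQμ]
    refine Finset.sum_pos' (fun z _ => mul_nonneg (hQμ.1 x z) (hf z).le)
      ⟨y, Finset.mem_univ y, mul_pos hy (hf y)⟩
  set h : (Fin n → S) → ℝ := fun x => logDiff (f x) (F x) with hh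
  have hterm : ∀ x y, ν x * resample ν i x y * logDiff (f x) (f y) ≤
      ν x * resample ν i x y * (5 * L * (h x + h y)) := by
    intro x y
    by_cases h0 : ν x * resample ν i x y = 0
    · rw [h0, zero_mul, zero_mul]
    · have hx : ν x ≠ 0 := left_ne_zero_of_mul h0
      have hl : lineMass μ i x ≠ 0 := fun hl =>
        hx (hac x (le_antisymm (hl ▸ le_lineMass hμ i x) (hμ x)))
      have hFy : F y = F x := by
        rw [hF]
        simp only [mulVec,
          resample_row_congr hl (agree_of_resample_ne_zero (right_ne_zero_of_mul h0))]
      refine mul_le_mul_of_nonneg_left ?_ (mul_nonneg (hν x) (hQ.1 x y))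
      simp only [hh, hFy]
      exact logDiff_le_through hL (hFpos x) (hfL x) (hFy ▸ hfL y)
  have hrow := sum_row_of_mem_rowStochastic hQ
  have h1 : ∑ x, ∑ y, ν x * resample ν i x y * h x = ∑ x, ν x * h x := by
    refine Finset.sum_congr rfl fun x _ => ?_
    rw [← Finset.sum_mul, ← Finset.mul_sum, hrow, mul_one]
  have h2 : ∑ x, ∑ y, ν x * resample ν i x y * h y = ∑ x, ν x * h x := by
    rw [Finset.sum_comm, ← h1]
    simp only [hb _ _]
  calc dirichletForm ν (resample ν i) f (fun x => Real.log (f x))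
      ≤ ∑ x, ∑ y, ν x * resample ν i x y * (5 * L * (h x + h y)) :=
        Finset.sum_le_sum fun x _ => Finset.sum_le_sum fun y _ => hterm x y
    _ = 5 * L * (∑ x, ∑ y, ν x * resample ν i x y * h x +
          ∑ x, ∑ y, ν x * resample ν i x y * h y) := by
        simp only [← Finset.sum_add_distrib, Finset.mul_sum]
        refine Finset.sum_congr rfl fun x _ => Finset.sum_congr rfl fun y _ => by ring
    _ = _ := by rw [h1, h2]; ring

section Mixture

variable {k : ℕ} {ρ : Fin k → ℝ} {ν : Fin k → (Fin n → S) → ℝ}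

/-- For functions that dominate their local averages, the Dirichlet forms of the components of a
mixture are controlled by the Dirichlet form of the mixture. -/
lemma sum_dirichletForm_le (hn : 1 ≤ n) (hρ : ρ ∈ stdSimplex ℝ (Fin k))
    (hν : ∀ a, ν a ∈ stdSimplex ℝ (Fin n → S)) {f : (Fin n → S) → ℝ} (hf : ∀ x, 0 < f x)
    (hreg : ∀ x, (glauber (mixture ρ ν) *ᵥ f) x ≤ 2 * f x) :
    ∑ a, ρ a * dirichletForm (ν a) (glauber (ν a)) f (fun x => Real.log (f x)) ≤
      10 * n * dirichletForm (mixture ρ ν) (glauber (mixture ρ ν)) f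
        (fun x => Real.log (f x)) := by
  set μ := mixture ρ ν with hμdef
  have hμ : ∀ x, 0 ≤ μ x := mixture_nonneg hρ hν
  have hn1 : (1 : ℝ) ≤ n := by exact_mod_cast hn
  have hL : (1 : ℝ) ≤ 2 * n := by linarith
  have hline : ∀ i, ∑ a, ρ a * dirichletForm (ν a) (resample (ν a) i) f (fun x => Real.log (f x))
      ≤ 10 * n * dirichletForm μ (resample μ i) f (fun x => Real.log (f x)) := by
    intro i
    have hfL : ∀ x, (resample μ i *ᵥ f) x ≤ 2 * n * f x := by
      intro x
      have h1 := resample_mulVec_le hμ (fun x => (hf x).le) i x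
      nlinarith [hreg x]
    have ha : ∀ a, ρ a * dirichletForm (ν a) (resample (ν a) i) f (fun x => Real.log (f x)) ≤
        ρ a * (10 * (2 * n) * ∑ x, ν a x * logDiff (f x) ((resample μ i *ᵥ f) x)) := by
      intro a
      rcases (hρ.1 a).eq_or_lt with h0 | h0
      · rw [← h0, zero_mul, zero_mul]
      · refine mul_le_mul_of_nonneg_left ?_ h0.le
        refine dirichletForm_resample_log_le hμ (hν a).1 (fun x hx => ?_) i hf hL hfL
        have h1 : ρ a * ν a x ≤ μ x := Finset.single_le_sum (f := fun a => ρ a * ν a x)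
          (fun b _ => mul_nonneg (hρ.1 b) ((hν b).1 x)) (Finset.mem_univ a)
        rw [hx] at h1
        exact le_antisymm (nonpos_of_mul_nonpos_right h1 h0) ((hν a).1 x)
    refine (Finset.sum_le_sum fun a _ => ha a).trans_eq ?_
    rw [dirichletForm_resample_log hμ, sum_mixture_mul]
    simp only [Finset.mul_sum]
    refine Finset.sum_congr rfl fun a _ => Finset.sum_congr rfl fun x _ => by ring
  simp only [dirichletForm_glauber]
  calc ∑ a, ρ a * (1 / (n : ℝ) * ∑ i, dirichletForm (ν a) (resample (ν a) i) f
        (fun x => Real.log (f x)))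
      = 1 / (n : ℝ) * ∑ i, ∑ a, ρ a * dirichletForm (ν a) (resample (ν a) i) f
        (fun x => Real.log (f x)) := by
        rw [Finset.sum_comm, Finset.mul_sum]
        simp only [Finset.mul_sum]
        refine Finset.sum_congr rfl fun a _ => Finset.sum_congr rfl fun x _ => by ring
    _ ≤ 1 / (n : ℝ) * ∑ i, 10 * n * dirichletForm μ (resample μ i) f
        (fun x => Real.log (f x)) := by
        gcongr with i
        exact hline i
    _ = _ := by rw [← Finset.mul_sum]; ring

/-- A weak modified log-Sobolev inequality for mixtures, for functions that dominate their local
averages; the defect is the entropy of the averages over the components. -/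
lemma sum_klFun_le_of_mlsi (hn : 1 ≤ n) (hρ : ρ ∈ stdSimplex ℝ (Fin k))
    (hν : ∀ a, ν a ∈ stdSimplex ℝ (Fin n → S)) {c : ℝ} (hc : 0 ≤ c)
    (hmlsi : ∀ a, SatisfiesMLSI (ν a) c) {f : (Fin n → S) → ℝ} (hf : ∀ x, 0 < f x)
    (hreg : ∀ x, (glauber (mixture ρ ν) *ᵥ f) x ≤ 2 * f x)
    (hf1 : ∑ x, mixture ρ ν x * f x = 1) :
    ∑ x, mixture ρ ν x * klFun (f x) ≤
      10 * n * c * dirichletForm (mixture ρ ν) (glauber (mixture ρ ν)) f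
        (fun x => Real.log (f x)) + ∑ a, ρ a * klFun (∑ x, ν a x * f x) := by
  have h1 := sum_dirichletForm_le hn hρ hν hf hreg
  have h2 : ∑ a, ρ a * entropy (ν a) f ≤ c * ∑ a, ρ a * dirichletForm (ν a) (glauber (ν a)) f
      (fun x => Real.log (f x)) := by
    rw [Finset.mul_sum]
    refine Finset.sum_le_sum fun a _ => ?_
    have := mul_le_mul_of_nonneg_left (hmlsi a f hf) (hρ.1 a)
    linarith
  -- Chain rule for the entropy of a mixture.
  have h3 : ∑ x, mixture ρ ν x * klFun (f x) =
      ∑ a, ρ a * entropy (ν a) f + ∑ a, ρ a * klFun (∑ x, ν a x * f x) := by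
    have h4 : ∑ a, ρ a * ∑ x, ν a x * f x = 1 := by rw [← sum_mixture_mul, hf1]
    have h5 : ∀ a, ∑ x, ν a x * klFun (f x) =
        entropy (ν a) f + klFun (∑ x, ν a x * f x) := by
      intro a
      simp only [klFun_apply, entropy, mul_sub, mul_add, Finset.sum_sub_distrib,
        Finset.sum_add_distrib, mul_one, (hν a).2]
      ring
    rw [sum_mixture_mul]
    simp only [h5, mul_add, Finset.sum_add_distrib]
  rw [h3]
  have := mul_le_mul_of_nonneg_left h1 hc
  linarith

end Mixture

end Glauber

end GlauberMixture

/-! ### Exponential moments of averaged posterior weights -/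

namespace GlauberMixture

open InformationTheory

section Moment

variable {Ω ι : Type*} [Fintype Ω] [Fintype ι]

/-- For one sample, Jensen with the posterior weights ρ(a) b_a(z) bounds the moment generating
function by Σ ρ(a) e^{g_a}, and 1 + s ≤ e^s puts it in Poisson form, a product over a. -/
lemma sum_prod_mul_exp_le {μ : Ω → ℝ} (hμ : ∀ z, 0 ≤ μ z) {ρ : ι → ℝ} (hρ : ρ ∈ stdSimplex ℝ ι)
    {b : ι → Ω → ℝ} (hb : ∀ a z, 0 ≤ b a z) (hb1 : ∀ z, μ z ≠ 0 → ∑ a, ρ a * b a z = 1)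
    (hbμ : ∀ a, ∑ z, μ z * b a z ≤ 1) (g : ι → ℝ) (m : ℕ) :
    ∑ x : Fin m → Ω, (∏ j, μ (x j)) * Real.exp (∑ a, ρ a * (∑ j, b a (x j)) * g a) ≤
      Real.exp (m * ∑ a, ρ a * (Real.exp (g a) - 1)) := by
  have h1 : ∀ x : Fin m → Ω, (∏ j, μ (x j)) * Real.exp (∑ a, ρ a * (∑ j, b a (x j)) * g a) =
      ∏ j, μ (x j) * Real.exp (∑ a, ρ a * b a (x j) * g a) := by
    intro x
    rw [Finset.prod_mul_distrib, ← Real.exp_sum]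
    congr 2
    simp only [Finset.mul_sum, Finset.sum_mul]
    exact Finset.sum_comm
  have h2 : ∑ z, μ z * Real.exp (∑ a, ρ a * b a z * g a) ≤ ∑ a, ρ a * Real.exp (g a) := by
    calc ∑ z, μ z * Real.exp (∑ a, ρ a * b a z * g a)
        ≤ ∑ z, μ z * ∑ a, ρ a * b a z * Real.exp (g a) := by
          refine Finset.sum_le_sum fun z _ => ?_
          rcases eq_or_ne (μ z) 0 with h0 | h0
          · rw [h0, zero_mul, zero_mul]
          · refine mul_le_mul_of_nonneg_left ?_ (hμ z)
            exact convexOn_exp.map_sum_le (fun a _ => mul_nonneg (hρ.1 a) (hb a z)) (hb1 z h0)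
              (fun a _ => Set.mem_univ _)
      _ = ∑ a, ρ a * Real.exp (g a) * ∑ z, μ z * b a z := by
          simp only [Finset.mul_sum]
          rw [Finset.sum_comm]
          refine Finset.sum_congr rfl fun a _ => Finset.sum_congr rfl fun z _ => by ring
      _ ≤ ∑ a, ρ a * Real.exp (g a) := by
          refine Finset.sum_le_sum fun a _ => mul_le_of_le_one_right ?_ (hbμ a)
          exact mul_nonneg (hρ.1 a) (Real.exp_pos _).le
  have h3 : ∑ a, ρ a * Real.exp (g a) ≤ Real.exp (∑ a, ρ a * (Real.exp (g a) - 1)) := by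
    have := Real.add_one_le_exp (∑ a, ρ a * (Real.exp (g a) - 1))
    simp only [mul_sub, mul_one, Finset.sum_sub_distrib, hρ.2] at this ⊢
    linarith
  simp only [h1]
  rw [← Fintype.sum_pow (fun z => μ z * Real.exp (∑ a, ρ a * b a z * g a)), Real.exp_nat_mul]
  refine pow_le_pow_left₀ (Finset.sum_nonneg fun z _ => ?_) (h2.trans h3) m
  exact mul_nonneg (hμ z) (Real.exp_pos _).le

/-- An exponential moment bound, independent of the number of samples, for the relative entropy of
averages of i.i.d. posterior weights with respect to the prior `ρ`. -/
lemma sum_prod_mul_exp_klFun_le {μ : Ω → ℝ} (hμ : ∀ z, 0 ≤ μ z) {ρ : ι → ℝ}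
    (hρ : ρ ∈ stdSimplex ℝ ι) {b : ι → Ω → ℝ} (hb : ∀ a z, 0 ≤ b a z)
    (hb1 : ∀ z, μ z ≠ 0 → ∑ a, ρ a * b a z = 1) (hbμ : ∀ a, ∑ z, μ z * b a z ≤ 1)
    {m : ℕ} (hm : m ≠ 0) :
    ∑ x : Fin m → Ω, (∏ j, μ (x j)) *
        Real.exp (m / 2 * ∑ a, ρ a * klFun ((1 / (m : ℝ)) * ∑ j, b a (x j))) ≤
      Real.exp (3 * Fintype.card ι) := by
  classical
  have hm0 : (m : ℝ) ≠ 0 := by exact_mod_cast hm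
  set u : ι → (Fin m → Ω) → ℝ := fun a x => (1 / (m : ℝ)) * ∑ j, b a (x j) with hu
  have hu0 : ∀ a x, 0 ≤ u a x := fun a x =>
    mul_nonneg (by positivity) (Finset.sum_nonneg fun j _ => hb a (x j))
  have hθ : ∀ a, 0 ≤ m * ρ a := fun a => mul_nonneg (by positivity) (hρ.1 a)
  -- Any cutoff will do, because the total peeling weight is bounded independently of N.
  obtain ⟨N, hN⟩ : ∃ N : ℕ, ∀ a x, m * ρ a * klFun (u a x) ≤ N := by
    obtain ⟨N, hN⟩ := exists_nat_ge (∑ a, ∑ x, m * ρ a * klFun (u a x))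
    refine ⟨N, fun a x => le_trans ?_ hN⟩
    have h0 : ∀ a x, 0 ≤ m * ρ a * klFun (u a x) := fun a x =>
      mul_nonneg (hθ a) (klFun_nonneg (hu0 a x))
    exact (Finset.single_le_sum (fun x _ => h0 a x) (Finset.mem_univ x)).trans
      (Finset.single_le_sum (f := fun a => ∑ x, m * ρ a * klFun (u a x))
        (fun a _ => Finset.sum_nonneg fun x _ => h0 a x) (Finset.mem_univ a))
  choose g hg using fun a => exists_exp_klFun_le_sum (hθ a) N
  set I : Finset (ℕ × Bool) := Finset.range (N + 1) ×ˢ Finset.univ with hI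
  have hpt : ∀ x, Real.exp (m / 2 * ∑ a, ρ a * klFun (u a x)) ≤
      ∑ p ∈ Fintype.piFinset fun _ : ι => I, (∏ a, peelWeight (p a)) *
        (Real.exp (∑ a, ρ a * (∑ j, b a (x j)) * g a (p a)) *
          Real.exp (-(m * ∑ a, ρ a * (Real.exp (g a (p a)) - 1)))) := by
    intro x
    calc Real.exp (m / 2 * ∑ a, ρ a * klFun (u a x))
        = ∏ a, Real.exp (m * ρ a * klFun (u a x) / 2) := by
          rw [← Real.exp_sum, Finset.mul_sum]
          congr 1
          refine Finset.sum_congr rfl fun a _ => by ring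
      _ ≤ ∏ a, ∑ i ∈ I, peelWeight i *
            Real.exp (m * ρ a * (u a x * g a i - (Real.exp (g a i) - 1))) :=
          Finset.prod_le_prod (fun a _ => (Real.exp_pos _).le)
            (fun a _ => hg a (u a x) (hu0 a x) (hN a x))
      _ = _ := by
          rw [Finset.prod_univ_sum]
          refine Finset.sum_congr rfl fun p _ => ?_
          rw [Finset.prod_mul_distrib, ← Real.exp_sum, ← Real.exp_add]
          congr 2
          rw [Finset.mul_sum, ← Finset.sum_neg_distrib, ← Finset.sum_add_distrib]
          refine Finset.sum_congr rfl fun a _ => ?_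
          simp only [hu]
          field_simp
          ring
  calc ∑ x : Fin m → Ω, (∏ j, μ (x j)) * Real.exp (m / 2 * ∑ a, ρ a * klFun (u a x))
      ≤ ∑ x : Fin m → Ω, (∏ j, μ (x j)) * ∑ p ∈ Fintype.piFinset fun _ : ι => I,
          (∏ a, peelWeight (p a)) * (Real.exp (∑ a, ρ a * (∑ j, b a (x j)) * g a (p a)) *
          Real.exp (-(m * ∑ a, ρ a * (Real.exp (g a (p a)) - 1)))) :=
        Finset.sum_le_sum fun x _ => mul_le_mul_of_nonneg_left (hpt x)
          (Finset.prod_nonneg fun j _ => hμ _)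
    _ = ∑ p ∈ Fintype.piFinset fun _ : ι => I, (∏ a, peelWeight (p a)) *
          (Real.exp (-(m * ∑ a, ρ a * (Real.exp (g a (p a)) - 1))) *
          ∑ x : Fin m → Ω, (∏ j, μ (x j)) *
            Real.exp (∑ a, ρ a * (∑ j, b a (x j)) * g a (p a))) := by
        simp only [Finset.mul_sum]
        rw [Finset.sum_comm]
        refine Finset.sum_congr rfl fun p _ => Finset.sum_congr rfl fun x _ => by ring
    _ ≤ ∑ p ∈ Fintype.piFinset fun _ : ι => I, (∏ a, peelWeight (p a)) * 1 := by
        refine Finset.sum_le_sum fun p _ => mul_le_mul_of_nonneg_left ?_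
          (Finset.prod_nonneg fun a _ => (Real.exp_pos _).le)
        -- The Poisson-type bound cancels the Legendre terms e^g - 1 exactly, leaving only the
        -- product of the total weights.
        have h := sum_prod_mul_exp_le hμ hρ hb hb1 hbμ (fun a => g a (p a)) m
        refine (mul_le_mul_of_nonneg_left h (Real.exp_pos _).le).trans_eq ?_
        rw [← Real.exp_add, neg_add_cancel, Real.exp_zero]
    _ = ∏ _a : ι, ∑ i ∈ I, peelWeight i := by
        rw [Finset.prod_univ_sum]
        simp only [mul_one]
    _ ≤ Real.exp (3 * Fintype.card ι) := by
        rw [Finset.prod_const, Finset.card_univ, mul_comm, Real.exp_nat_mul]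
        exact pow_le_pow_left₀ (Finset.sum_nonneg fun i _ => (Real.exp_pos _).le)
          (sum_peelWeight_le _) _

end Moment

end GlauberMixture

/-! ### Relative entropy and Markov's inequality on finite spaces -/

namespace GlauberMixture

open InformationTheory MeasureTheory

section Measure

variable {Ω : Type*} [Fintype Ω] [MeasurableSpace Ω]

instance isFiniteMeasure_toMeasure (w : Ω → ℝ) : IsFiniteMeasure (toMeasure w) := by
  refine ⟨?_⟩
  simp [toMeasure, Measure.finsetSum_apply, ENNReal.sum_lt_top]

variable [MeasurableSingletonClass Ω]

lemma lintegral_toMeasure (w : Ω → ℝ) (g : Ω → ENNReal) :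
    ∫⁻ x, g x ∂(toMeasure w) = ∑ x, ENNReal.ofReal (w x) * g x := by
  simp [toMeasure, lintegral_smul_measure, lintegral_dirac]

lemma toMeasure_apply (w : Ω → ℝ) (s : Set Ω) :
    toMeasure w s = ∑ x, ENNReal.ofReal (w x) * s.indicator 1 x := by
  rw [← lintegral_toMeasure, lintegral_indicator_one s.toFinite.measurableSet]

lemma toMeasure_singleton (w : Ω → ℝ) (x : Ω) : toMeasure w {x} = ENNReal.ofReal (w x) := by
  rw [toMeasure_apply, Finset.sum_eq_single x]
  · simp
  · intro y _ hy
    simp [hy]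
  · simp

lemma toMeasure_mul_eq_withDensity {μ f : Ω → ℝ} (hμ : ∀ x, 0 ≤ μ x) :
    toMeasure (fun x => μ x * f x) = (toMeasure μ).withDensity fun x => ENNReal.ofReal (f x) := by
  ext s hs
  rw [withDensity_apply _ hs, ← lintegral_indicator hs, lintegral_toMeasure, toMeasure_apply]
  refine Finset.sum_congr rfl fun x _ => ?_
  rw [ENNReal.ofReal_mul (hμ x), mul_assoc]
  by_cases hx : x ∈ s <;> simp [hx]

lemma klDiv_toMeasure_mul {μ f : Ω → ℝ} (hμ : ∀ x, 0 ≤ μ x) (hf : ∀ x, 0 ≤ f x) :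
    klDiv (toMeasure fun x => μ x * f x) (toMeasure μ) =
      ENNReal.ofReal (∑ x, μ x * klFun (f x)) := by
  rw [toMeasure_mul_eq_withDensity hμ]
  have hac := withDensity_absolutelyContinuous (toMeasure μ) fun x => ENNReal.ofReal (f x)
  have hmeas : Measurable fun x => ENNReal.ofReal (f x) := measurable_of_finite _
  have hfin : IsFiniteMeasure ((toMeasure μ).withDensity fun x => ENNReal.ofReal (f x)) := by
    rw [← toMeasure_mul_eq_withDensity hμ]
    infer_instance
  rw [klDiv_eq_lintegral_klFun_of_ac hac]
  have hrn := Measure.rnDeriv_withDensity (toMeasure μ) hmeas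
  rw [lintegral_congr_ae (g := fun x => ENNReal.ofReal (klFun (f x)))
    (by filter_upwards [hrn] with x hx; rw [hx, ENNReal.toReal_ofReal (hf x)]),
    lintegral_toMeasure, ENNReal.ofReal_sum_of_nonneg
      fun x _ => mul_nonneg (hμ x) (klFun_nonneg (hf x))]
  simp only [ENNReal.ofReal_mul (hμ _)]

/-- Markov's inequality for the exponential of a function of `m` independent samples. -/
lemma pi_toMeasure_le_of_exp {μ : Ω → ℝ} (hμ : ∀ x, 0 ≤ μ x) {m : ℕ} {s : Set (Fin m → Ω)}
    {Z : (Fin m → Ω) → ℝ} {z : ℝ} (hs : ∀ x ∈ s, (∀ j, μ (x j) ≠ 0) → z ≤ Z x) :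
    Measure.pi (fun _ : Fin m => toMeasure μ) s ≤
      ENNReal.ofReal (Real.exp (-z) * ∑ x, (∏ j, μ (x j)) * Real.exp (Z x)) := by
  classical
  have h0 : ∀ x : Fin m → Ω, 0 ≤ ∏ j, μ (x j) := fun x => Finset.prod_nonneg fun j _ => hμ _
  have h1 : Measure.pi (fun _ : Fin m => toMeasure μ) s =
      ∑ x ∈ s.toFinset, ENNReal.ofReal (∏ j, μ (x j)) := by
    conv_lhs => rw [← Set.coe_toFinset s]
    rw [← sum_measure_singleton]
    refine Finset.sum_congr rfl fun x _ => ?_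
    rw [Measure.pi_singleton, ENNReal.ofReal_prod_of_nonneg fun j _ => hμ _]
    simp only [toMeasure_singleton]
  rw [h1, ← ENNReal.ofReal_sum_of_nonneg fun x _ => h0 x]
  refine ENNReal.ofReal_le_ofReal ?_
  rw [Finset.mul_sum]
  refine (Finset.sum_le_sum fun x hx => ?_).trans
    (Finset.sum_le_sum_of_subset_of_nonneg (Finset.subset_univ s.toFinset)
      fun x _ _ => mul_nonneg (Real.exp_pos _).le (mul_nonneg (h0 x) (Real.exp_pos _).le))
  rw [Set.mem_toFinset] at hx
  by_cases hne : ∀ j, μ (x j) ≠ 0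
  · rw [mul_left_comm, ← Real.exp_add]
    refine le_mul_of_one_le_right (h0 x) (Real.one_le_exp ?_)
    linarith [hs x hx hne]
  · push Not at hne
    obtain ⟨j, hj⟩ := hne
    rw [Finset.prod_eq_zero (Finset.mem_univ j) hj]
    simp

end Measure

end GlauberMixture

/-! ### Grönwall for exponential moments; smoothed and empirical densities -/

namespace GlauberMixture

open InformationTheory Matrix NormedSpace

/-- A Grönwall argument for exponential moments: if each `z x` relaxes towards `d x` at rate `1 / κ`
and the exponential moments of `d` are bounded by `A`, then so are those of `z`. -/
lemma sum_exp_le_of_deriv_le {X : Type*} [Fintype X] {w : X → ℝ} (hw : ∀ x, 0 ≤ w x)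
    {z z' d : X → ℝ → ℝ} {κ A : ℝ} (hκ : 0 < κ)
    (hz : ∀ x t, 0 ≤ t → HasDerivAt (z x) (z' x t) t)
    (hz0 : ∀ x, z x 0 = 0) (hA : ∑ x, w x ≤ A)
    (hle : ∀ x t, w x ≠ 0 → 0 ≤ t → z' x t ≤ (d x t - z x t) / κ)
    (hd : ∀ t, 0 ≤ t → ∑ x, w x * Real.exp (d x t) ≤ A) {t : ℝ} (ht : 0 ≤ t) :
    ∑ x, w x * Real.exp (z x t) ≤ A := by
  set M : ℝ → ℝ := fun s => ∑ x, w x * Real.exp (z x s) with hM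
  have hMd : ∀ s, 0 ≤ s → HasDerivAt M (∑ x, w x * (Real.exp (z x s) * z' x s)) s := fun s hs =>
    HasDerivAt.fun_sum fun x _ => ((hz x s hs).exp).const_mul (w x)
  have hNd : ∀ s, 0 ≤ s → HasDerivAt (fun s => (M s - A) * Real.exp (s / κ))
      ((∑ x, w x * (Real.exp (z x s) * z' x s)) * Real.exp (s / κ) +
        (M s - A) * (Real.exp (s / κ) * (1 / κ))) s := fun s hs =>
    ((hMd s hs).sub_const A).mul (((hasDerivAt_id s).div_const κ).exp)
  have hbound : ∀ s, 0 ≤ s → ∑ x, w x * (Real.exp (z x s) * z' x s) ≤ (A - M s) / κ := by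
    intro s hs
    have hterm : ∀ x, w x * (Real.exp (z x s) * z' x s) ≤
        (w x * Real.exp (d x s) - w x * Real.exp (z x s)) / κ := by
      intro x
      rcases eq_or_ne (w x) 0 with h0 | h0
      · simp [h0]
      -- Convexity of exp turns the pointwise relaxation of z towards d into the relaxation of the
      -- exponential moment towards that of d.
      · have h1 : Real.exp (z x s) * (d x s - z x s) ≤ Real.exp (d x s) - Real.exp (z x s) := by
          have h2 := Real.add_one_le_exp (d x s - z x s)
          have h3 : Real.exp (d x s) = Real.exp (z x s) * Real.exp (d x s - z x s) := by
            rw [← Real.exp_add]; ring_nf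
          rw [h3]
          nlinarith [Real.exp_pos (z x s)]
        calc w x * (Real.exp (z x s) * z' x s)
            ≤ w x * (Real.exp (z x s) * ((d x s - z x s) / κ)) := by
              have := hle x s h0 hs
              have := hw x
              gcongr
          _ = w x * (Real.exp (z x s) * (d x s - z x s)) / κ := by ring
          _ ≤ w x * (Real.exp (d x s) - Real.exp (z x s)) / κ := by
              have := hw x
              gcongr
          _ = _ := by ring
    calc ∑ x, w x * (Real.exp (z x s) * z' x s)
        ≤ ∑ x, (w x * Real.exp (d x s) - w x * Real.exp (z x s)) / κ :=
          Finset.sum_le_sum fun x _ => hterm x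
      _ = (∑ x, w x * Real.exp (d x s) - M s) / κ := by
          rw [← Finset.sum_div, Finset.sum_sub_distrib]
      _ ≤ (A - M s) / κ := by
          have := hd s hs
          gcongr
  have hanti : AntitoneOn (fun s => (M s - A) * Real.exp (s / κ)) (Set.Ici 0) := by
    refine antitoneOn_of_deriv_nonpos (convex_Ici 0)
      (fun s hs => (hNd s hs).continuousAt.continuousWithinAt)
      (fun s hs => ?_) (fun s hs => ?_)
    · rw [interior_Ici] at hs
      exact (hNd s hs.le).differentiableAt.differentiableWithinAt
    · rw [interior_Ici] at hs
      rw [(hNd s hs.le).deriv]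
      have h1 := mul_le_mul_of_nonneg_right (hbound s hs.le) (Real.exp_pos (s / κ)).le
      have h2 : (M s - A) * (Real.exp (s / κ) * (1 / κ)) =
          -((A - M s) / κ * Real.exp (s / κ)) := by ring
      linarith
  have h0 := hanti (Set.self_mem_Ici) ht ht
  have hM0 : M 0 ≤ A := by simpa [hM, hz0] using hA
  simp only [zero_div, Real.exp_zero, mul_one] at h0
  have h1 : (M t - A) * Real.exp (t / κ) ≤ 0 := h0.trans (by linarith)
  have h2 := nonpos_of_mul_nonpos_left h1 (Real.exp_pos _)
  linarith

lemma sum_mul_mulVec {Ω : Type*} [Fintype Ω] {P : Matrix Ω Ω ℝ} {μ : Ω → ℝ}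
    (g : Ω → ℝ) (hμ : μ ᵥ* P = μ) :
    ∑ x, μ x * (P *ᵥ g) x = ∑ x, μ x * g x := by
  change μ ⬝ᵥ (P *ᵥ g) = μ ⬝ᵥ g
  rw [dotProduct_mulVec, hμ]

section Smoothing

variable {Ω : Type*} [Fintype Ω] [DecidableEq Ω]

/-- The density `f`, averaged with the constant `1`, smoothed by the resolvent and run for time `t`
along the chain. -/
noncomputable def smoothed (P : Matrix Ω Ω ℝ) (f : Ω → ℝ) (t : ℝ) : Ω → ℝ :=
  exp (t • (P - 1)) *ᵥ (resolvent P *ᵥ fun x => (1 + f x) / 2)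

variable {P : Matrix Ω Ω ℝ} {f : Ω → ℝ} {t : ℝ}

lemma smoothed_eq (hP : P ∈ rowStochastic ℝ Ω) (ht : 0 ≤ t) :
    smoothed P f t = fun x => (1 + ((exp (t • (P - 1)) * resolvent P) *ᵥ f) x) / 2 := by
  have hK := (rowStochastic ℝ Ω).mul_mem (exp_generator_mem_rowStochastic hP ht)
    (resolvent_mem_rowStochastic hP)
  have h : (fun x => (1 + f x) / 2) = (1 / 2 : ℝ) • (1 + f) := by
    ext x; simp; ring
  unfold smoothed
  rw [mulVec_mulVec, h, mulVec_smul, mulVec_add, hK.2]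
  ext x; simp; ring

/-- Averaging with 1 keeps the density at least 1/2, so that its logarithm and the derivative of the
entropy make sense. -/
lemma smoothed_pos (hP : P ∈ rowStochastic ℝ Ω) (ht : 0 ≤ t) (hf : ∀ x, 0 ≤ f x) (x : Ω) :
    0 < smoothed P f t x := by
  rw [smoothed_eq hP ht]
  have hK := (rowStochastic ℝ Ω).mul_mem (exp_generator_mem_rowStochastic hP ht)
    (resolvent_mem_rowStochastic hP)
  have := nonneg_mulVec_of_mem_rowStochastic hK hf x
  positivity

/-- Smoothing by the resolvent can be undone by an extrapolation. -/
lemma two_mul_smoothed_sub (hP : P ∈ rowStochastic ℝ Ω) (ht : 0 ≤ t) (x : Ω) :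
    2 * smoothed P f t x - (P *ᵥ smoothed P f t) x =
      (1 + (exp (t • (P - 1)) *ᵥ f) x) / 2 := by
  have hE := exp_generator_mem_rowStochastic hP ht
  have hcomm : Commute P (exp (t • (P - 1))) := by
    have h1 : Commute P (t • (P - 1)) :=
      ((Commute.refl P).sub_right (Commute.one_right P)).smul_right t
    exact mul_exp_eq_exp_mul h1.eq
  have h1 : ((2 : ℝ) • 1 - P) *ᵥ smoothed P f t =
      exp (t • (P - 1)) *ᵥ fun x => (1 + f x) / 2 := by
    have h2 : ((2 : ℝ) • 1 - P) * exp (t • (P - 1)) =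
        exp (t • (P - 1)) * ((2 : ℝ) • 1 - P) :=
      (((Commute.one_left _).smul_left _).sub_left hcomm).eq
    unfold smoothed
    rw [mulVec_mulVec, h2, ← mulVec_mulVec, mulVec_mulVec _ _ (resolvent P),
      two_smul_sub_mul_resolvent hP, one_mulVec]
  have h : (fun x => (1 + f x) / 2) = (1 / 2 : ℝ) • (1 + f) := by
    ext x; simp; ring
  rw [h, mulVec_smul, mulVec_add, hE.2, sub_mulVec, smul_mulVec, one_mulVec] at h1
  have h3 := congrFun h1 x
  simp only [Pi.sub_apply, Pi.smul_apply, smul_eq_mul, Pi.add_apply, Pi.one_apply] at h3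
  rw [h3]
  ring

lemma mulVec_smoothed_le (hP : P ∈ rowStochastic ℝ Ω) (ht : 0 ≤ t) (hf : ∀ x, 0 ≤ f x) (x : Ω) :
    (P *ᵥ smoothed P f t) x ≤ 2 * smoothed P f t x := by
  have h1 := two_mul_smoothed_sub (f := f) hP ht x
  have h2 := nonneg_mulVec_of_mem_rowStochastic (exp_generator_mem_rowStochastic hP ht) hf x
  linarith

variable {μ : Ω → ℝ}

lemma vecMul_exp_mul_resolvent (hP : P ∈ rowStochastic ℝ Ω) (hb : DetailedBalance μ P)
    (ht : 0 ≤ t) : μ ᵥ* (exp (t • (P - 1)) * resolvent P) = μ := by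
  rw [← vecMul_vecMul, (hb.exp_generator t).vecMul_eq (exp_generator_mem_rowStochastic hP ht),
    vecMul_resolvent hP (hb.vecMul_eq hP)]

lemma sum_mul_smoothed (hP : P ∈ rowStochastic ℝ Ω) (hb : DetailedBalance μ P) (ht : 0 ≤ t)
    (hμ1 : ∑ x, μ x = 1) (hf1 : ∑ x, μ x * f x = 1) : ∑ x, μ x * smoothed P f t x = 1 := by
  rw [smoothed_eq hP ht]
  have h := sum_mul_mulVec f (vecMul_exp_mul_resolvent hP hb ht)
  have h2 : ∀ a b : ℝ, a * ((1 + b) / 2) = (a + a * b) / 2 := fun a b => by ring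
  simp only [h2]
  rw [← Finset.sum_div, Finset.sum_add_distrib, h, hμ1, hf1]
  norm_num

/-- The entropy before smoothing is bounded by a multiple of the entropy after smoothing. -/
lemma sum_klFun_exp_mulVec_le (hP : P ∈ rowStochastic ℝ Ω) (hb : DetailedBalance μ P)
    (ht : 0 ≤ t) (hμ : ∀ x, 0 ≤ μ x) (hf : ∀ x, 0 ≤ f x) :
    ∑ x, μ x * klFun ((exp (t • (P - 1)) *ᵥ f) x) ≤
      10368 * ∑ x, μ x * klFun (smoothed P f t x) := by
  set g := smoothed P f t with hg
  have hg0 : ∀ x, 0 ≤ g x := fun x => (smoothed_pos hP ht hf x).le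
  have hft := nonneg_mulVec_of_mem_rowStochastic (exp_generator_mem_rowStochastic hP ht) hf
  have hPg := nonneg_mulVec_of_mem_rowStochastic hP hg0
  -- Two extrapolations, 2g - Pg and then 2(2g - Pg) - 1, give 72² = 5184, with klFun 1 = 0.
  -- Contraction of entropy under P then doubles it.
  have hpt : ∀ x, klFun ((exp (t • (P - 1)) *ᵥ f) x) ≤
      5184 * (klFun (g x) + klFun ((P *ᵥ g) x)) := by
    intro x
    have h1 := two_mul_smoothed_sub (f := f) hP ht x
    rw [← hg] at h1
    have h2 : (exp (t • (P - 1)) *ᵥ f) x = 2 * (2 * g x - (P *ᵥ g) x) - 1 := by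
      rw [h1]; ring
    have h3 : 0 ≤ 2 * g x - (P *ᵥ g) x := by
      rw [h1]; have := hft x; positivity
    have h4 := klFun_two_mul_sub_le (hg0 x) (hPg x) h3
    have h5 := klFun_two_mul_sub_le h3 zero_le_one (by rw [← h2]; exact hft x)
    rw [klFun_one, add_zero] at h5
    rw [h2]
    linarith
  have hJ := sum_klFun_mulVec_le hμ hP (hb.vecMul_eq hP) hg0
  calc ∑ x, μ x * klFun ((exp (t • (P - 1)) *ᵥ f) x)
      ≤ ∑ x, μ x * (5184 * (klFun (g x) + klFun ((P *ᵥ g) x))) :=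
        Finset.sum_le_sum fun x _ => mul_le_mul_of_nonneg_left (hpt x) (hμ x)
    _ = 5184 * (∑ x, μ x * klFun (g x) + ∑ x, μ x * klFun ((P *ᵥ g) x)) := by
        rw [← Finset.sum_add_distrib, Finset.mul_sum]
        refine Finset.sum_congr rfl fun x _ => by ring
    _ ≤ _ := by linarith

lemma sum_klFun_smoothed_zero_le (hP : P ∈ rowStochastic ℝ Ω) (hb : DetailedBalance μ P)
    (hμ : ∀ x, 0 ≤ μ x) (hf : ∀ x, 0 ≤ f x) :
    ∑ x, μ x * klFun (smoothed P f 0 x) ≤ ∑ x, μ x * klFun (f x) := by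
  have h0 : smoothed P f 0 = resolvent P *ᵥ fun x => (1 + f x) / 2 := by
    simp [smoothed]
  rw [h0]
  refine (sum_klFun_mulVec_le hμ (resolvent_mem_rowStochastic hP)
    (vecMul_resolvent hP (hb.vecMul_eq hP)) fun x => ?_).trans
    (Finset.sum_le_sum fun x _ => mul_le_mul_of_nonneg_left ?_ (hμ x))
  · have := hf x; positivity
  · have h1 := klFun_convex_combination zero_le_one (hf x)
    rw [klFun_one] at h1
    have := klFun_nonneg (hf x)
    linarith

end Smoothing

section MinMass

variable {Ω : Type*} [Fintype Ω] {μ : Ω → ℝ}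

lemma minMass_le {x : Ω} (hx : 0 < μ x) : minMass μ ≤ μ x :=
  csInf_le (Set.toFinite _).bddBelow ⟨x, hx, rfl⟩

lemma minMass_pos {x : Ω} (hx : 0 < μ x) : 0 < minMass μ := by
  obtain ⟨y, hy, h⟩ := Set.Nonempty.csInf_mem (s := μ '' {x | 0 < μ x}) ⟨_, x, hx, rfl⟩
    (Set.toFinite _)
  unfold minMass
  rw [← h]
  exact hy

/-- A probability density is at most 1/μ(x) at each x of the support. -/
lemma sum_klFun_le_log_inv_minMass (hμ : ∀ x, 0 ≤ μ x) (hμ1 : ∑ x, μ x = 1) {f : Ω → ℝ}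
    (hf : ∀ x, 0 ≤ f x) (hf1 : ∑ x, μ x * f x = 1) :
    ∑ x, μ x * klFun (f x) ≤ Real.log (1 / minMass μ) := by
  have hle : ∀ x, μ x * f x ≤ 1 := fun x => by
    rw [← hf1]
    exact Finset.single_le_sum (f := fun x => μ x * f x) (fun y _ => mul_nonneg (hμ y) (hf y))
      (Finset.mem_univ x)
  have hterm : ∀ x, μ x * (f x * Real.log (f x)) ≤ μ x * f x * Real.log (1 / minMass μ) := by
    intro x
    rcases (hμ x).eq_or_lt with h0 | h0
    · simp [← h0]
    rcases (hf x).eq_or_lt with h1 | h1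
    · simp [← h1]
    rw [mul_assoc]
    gcongr
    calc f x ≤ 1 / μ x := by rw [le_div_iff₀ h0, mul_comm]; exact hle x
      _ ≤ 1 / minMass μ := one_div_le_one_div_of_le (minMass_pos h0) (minMass_le h0)
  calc ∑ x, μ x * klFun (f x) = ∑ x, μ x * (f x * Real.log (f x)) := by
        simp only [klFun_apply, mul_sub, mul_add, Finset.sum_sub_distrib, Finset.sum_add_distrib,
          mul_one, hf1, hμ1, add_sub_cancel_right]
    _ ≤ ∑ x, μ x * f x * Real.log (1 / minMass μ) := Finset.sum_le_sum fun x _ => hterm x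
    _ = _ := by rw [← Finset.sum_mul, hf1, one_mul]

end MinMass

section Empirical

variable {Ω : Type*} [DecidableEq Ω] {m : ℕ}

lemma empirical_nonneg (x : Fin m → Ω) (z : Ω) : 0 ≤ empirical x z :=
  mul_nonneg (by positivity) (Finset.sum_nonneg fun j _ => by split_ifs <;> norm_num)

lemma empirical_eq_zero {x : Fin m → Ω} {z : Ω} (h : ∀ j, x j ≠ z) : empirical x z = 0 := by
  simp [empirical, h]

/-- The density of the empirical distribution with respect to `μ`. -/
noncomputable def empiricalDensity (μ : Ω → ℝ) (x : Fin m → Ω) : Ω → ℝ :=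
  fun z => empirical x z / μ z

lemma empiricalDensity_nonneg {μ : Ω → ℝ} (hμ : ∀ z, 0 ≤ μ z) (x : Fin m → Ω) (z : Ω) :
    0 ≤ empiricalDensity μ x z := div_nonneg (empirical_nonneg x z) (hμ z)

lemma mul_empiricalDensity {μ : Ω → ℝ} {x : Fin m → Ω} (hx : ∀ j, μ (x j) ≠ 0) (z : Ω) :
    μ z * empiricalDensity μ x z = empirical x z := by
  by_cases h : μ z = 0
  · rw [h, zero_mul, empirical_eq_zero]
    rintro j rfl
    exact hx j h
  · exact mul_div_cancel₀ _ h

variable [Fintype Ω]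

lemma sum_empirical_mul (x : Fin m → Ω) (h : Ω → ℝ) :
    ∑ z, empirical x z * h z = (1 / (m : ℝ)) * ∑ j, h (x j) := by
  simp only [empirical, mul_assoc, Finset.sum_mul]
  rw [← Finset.mul_sum, Finset.sum_comm]
  simp

lemma sum_mul_empiricalDensity {μ : Ω → ℝ} (hm : m ≠ 0) {x : Fin m → Ω}
    (hx : ∀ j, μ (x j) ≠ 0) : ∑ z, μ z * empiricalDensity μ x z = 1 := by
  have hm0 : (m : ℝ) ≠ 0 := by exact_mod_cast hm
  have := sum_empirical_mul x fun _ => 1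
  simp only [mul_empiricalDensity hx]
  simpa [hm0] using this

/-- Averages of the evolved density are empirical means over the samples; this is where independence
of the x_j becomes usable. -/
lemma dotProduct_mulVec_empiricalDensity (μ ν : Ω → ℝ) (K : Matrix Ω Ω ℝ) (x : Fin m → Ω) :
    ∑ y, ν y * (K *ᵥ empiricalDensity μ x) y =
      (1 / (m : ℝ)) * ∑ j, (ν ᵥ* K) (x j) / μ (x j) := by
  rw [← sum_empirical_mul x fun z => (ν ᵥ* K) z / μ z]
  change ν ⬝ᵥ (K *ᵥ empiricalDensity μ x) = _
  rw [dotProduct_mulVec, dotProduct]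
  refine Finset.sum_congr rfl fun z _ => ?_
  unfold empiricalDensity
  ring

end Empirical

end GlauberMixture

/-! ### Entropy dissipation from an empirical start -/

namespace GlauberMixture

open InformationTheory Matrix NormedSpace

section Main

variable {n k : ℕ} {S : Type*} [Fintype S] [DecidableEq S] {ρ : Fin k → ℝ}
  {ν : Fin k → (Fin n → S) → ℝ}

/-- Along the smoothed chain, entropy relaxes towards the entropy between the components. -/
lemma dissipation_le (hn : 1 ≤ n) (hρ : ρ ∈ stdSimplex ℝ (Fin k))
    (hν : ∀ a, ν a ∈ stdSimplex ℝ (Fin n → S)) {c : ℝ} (hc : 0 < c)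
    (hmlsi : ∀ a, SatisfiesMLSI (ν a) c) {f : (Fin n → S) → ℝ} (hf : ∀ x, 0 ≤ f x)
    (hf1 : ∑ x, mixture ρ ν x * f x = 1) {t : ℝ} (ht : 0 ≤ t) :
    -(1 / 2) * dirichletForm (mixture ρ ν) (glauber (mixture ρ ν))
        (smoothed (glauber (mixture ρ ν)) f t)
        (fun x => Real.log (smoothed (glauber (mixture ρ ν)) f t x)) ≤
      (1 / 2 * ∑ a, ρ a * klFun (∑ y, ν a y * ((exp (t • (glauber (mixture ρ ν) - 1)) *
          resolvent (glauber (mixture ρ ν))) *ᵥ f) y) -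
        ∑ x, mixture ρ ν x * klFun (smoothed (glauber (mixture ρ ν)) f t x)) / (20 * n * c) := by
  set μ := mixture ρ ν with hμdef
  have hμ : ∀ x, 0 ≤ μ x := mixture_nonneg hρ hν
  have hP := glauber_mem_rowStochastic hn hμ
  have hb := detailedBalance_glauber hμ
  set g := smoothed (glauber μ) f t with hg
  have hweak := sum_klFun_le_of_mlsi hn hρ hν hc.le hmlsi (smoothed_pos hP ht hf)
    (mulVec_smoothed_le hP ht hf) (sum_mul_smoothed hP hb ht (sum_mixture hρ hν) hf1)
  rw [← hμdef, ← hg] at hweak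
  have hK := (rowStochastic ℝ (Fin n → S)).mul_mem (exp_generator_mem_rowStochastic hP ht)
    (resolvent_mem_rowStochastic hP)
  -- Averaging with 1 gains a factor 1/2 by convexity, which is the 1/2 that the exponential moment
  -- bound requires.
  have hav : ∀ a, klFun (∑ x, ν a x * g x) ≤ 1 / 2 * klFun (∑ y, ν a y *
      ((exp (t • (glauber μ - 1)) * resolvent (glauber μ)) *ᵥ f) y) := by
    intro a
    set u := ∑ y, ν a y * ((exp (t • (glauber μ - 1)) * resolvent (glauber μ)) *ᵥ f) y with hu
    have hu0 : 0 ≤ u := Finset.sum_nonneg fun y _ =>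
      mul_nonneg ((hν a).1 y) (nonneg_mulVec_of_mem_rowStochastic hK hf y)
    have h1 : ∑ x, ν a x * g x = (1 + u) / 2 := by
      have h2 : ∀ a b : ℝ, a * ((1 + b) / 2) = (a + a * b) / 2 := fun a b => by ring
      rw [hg, smoothed_eq hP ht]
      simp only [h2]
      rw [← Finset.sum_div, Finset.sum_add_distrib, (hν a).2]
    have h3 := klFun_convex_combination zero_le_one hu0
    rw [klFun_one] at h3
    rw [h1]
    linarith
  have hD : ∑ a, ρ a * klFun (∑ x, ν a x * g x) ≤ 1 / 2 * ∑ a, ρ a * klFun (∑ y, ν a y *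
      ((exp (t • (glauber μ - 1)) * resolvent (glauber μ)) *ᵥ f) y) := by
    rw [Finset.mul_sum]
    refine Finset.sum_le_sum fun a _ => ?_
    have := mul_le_mul_of_nonneg_left (hav a) (hρ.1 a)
    linarith
  have hn0 : (0 : ℝ) < n := by exact_mod_cast hn
  -- The rate is 20 n c = 2 · 10 n c: the entropy decreases at half the Dirichlet form.
  rw [le_div_iff₀ (by positivity)]
  linarith

/-- Exponential moments of the entropy of the smoothed chain started from an empirical
distribution, up to a term that decays exponentially in time. -/
lemma sum_prod_mul_exp_entropy_le (hn : 1 ≤ n) (hρ : ρ ∈ stdSimplex ℝ (Fin k))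
    (hν : ∀ a, ν a ∈ stdSimplex ℝ (Fin n → S)) {c : ℝ} (hc : 0 < c)
    (hmlsi : ∀ a, SatisfiesMLSI (ν a) c) {m : ℕ} (hm : m ≠ 0) {t : ℝ} (ht : 0 ≤ t) :
    ∑ x : Fin m → (Fin n → S), (∏ j, mixture ρ ν (x j)) * Real.exp (m *
      (∑ y, mixture ρ ν y * klFun (smoothed (glauber (mixture ρ ν))
          (empiricalDensity (mixture ρ ν) x) t y) -
        Real.exp (-t / (20 * n * c)) * ∑ y, mixture ρ ν y * klFun (smoothed
          (glauber (mixture ρ ν)) (empiricalDensity (mixture ρ ν) x) 0 y))) ≤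
      Real.exp (3 * k) := by
  set μ := mixture ρ ν with hμdef
  have hμ : ∀ x, 0 ≤ μ x := mixture_nonneg hρ hν
  have hP := glauber_mem_rowStochastic hn hμ
  have hb := detailedBalance_glauber hμ
  have hn0 : (0 : ℝ) < n := by exact_mod_cast hn
  set κ := 20 * n * c with hκ
  have hκ0 : 0 < κ := by positivity
  set f : (Fin m → (Fin n → S)) → (Fin n → S) → ℝ := fun x => empiricalDensity μ x with hf
  have hf0 : ∀ x y, 0 ≤ f x y := fun x y => empiricalDensity_nonneg hμ x y
  set Γ : (Fin m → (Fin n → S)) → ℝ → ℝ := fun x s =>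
    ∑ y, μ y * klFun (smoothed (glauber μ) (f x) s y) with hΓ
  set D : (Fin m → (Fin n → S)) → ℝ → ℝ := fun x s => 1 / 2 * ∑ a, ρ a * klFun (∑ y, ν a y *
    ((exp (s • (glauber μ - 1)) * resolvent (glauber μ)) *ᵥ f x) y) with hD
  have hdecay : ∀ s : ℝ, HasDerivAt (fun s => Real.exp (-s / κ))
      (Real.exp (-s / κ) * (-1 / κ)) s := fun s =>
    (((hasDerivAt_id s).neg).div_const κ).exp
  -- Subtracting the exponentially decaying share of the initial entropy makes z vanish at time 0,
  -- where the entropy itself can be large, without changing the relaxation equation.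
  refine sum_exp_le_of_deriv_le (fun x => Finset.prod_nonneg fun j _ => hμ _) (κ := κ)
    (z := fun x s => m * (Γ x s - Real.exp (-s / κ) * Γ x 0))
    (z' := fun x s => m * (-(1 / 2) * dirichletForm μ (glauber μ) (smoothed (glauber μ) (f x) s)
      (fun y => Real.log (smoothed (glauber μ) (f x) s y)) -
      Real.exp (-s / κ) * (-1 / κ) * Γ x 0))
    (d := fun x s => m * D x s) hκ0 ?_ ?_ ?_ ?_ ?_ ht
  · intro x s hs
    refine HasDerivAt.const_mul _ (HasDerivAt.sub ?_ ((hdecay s).mul_const _))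
    exact hasDerivAt_sum_klFun hP hb _ s fun y => (smoothed_pos hP hs (hf0 x) y).ne'
  · intro x
    simp
  · rw [← Fintype.sum_pow μ, sum_mixture hρ hν, one_pow]
    exact Real.one_le_exp (by positivity)
  · intro x s hx hs
    have hx' : ∀ j, μ (x j) ≠ 0 := fun j hj => hx (Finset.prod_eq_zero (Finset.mem_univ j) hj)
    have h1 := dissipation_le hn hρ hν hc hmlsi (hf0 x) (sum_mul_empiricalDensity hm hx') hs
    have h2 : (m : ℝ) * (D x s - Γ x s) / κ + m * (Real.exp (-s / κ) * Γ x 0) / κ =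
        (m * D x s - m * (Γ x s - Real.exp (-s / κ) * Γ x 0)) / κ := by ring
    have h3 := mul_le_mul_of_nonneg_left h1 (Nat.cast_nonneg (α := ℝ) m)
    rw [← h2]
    refine le_trans (le_of_eq ?_) (add_le_add_left
      (h3.trans_eq (mul_div_assoc _ _ _).symm) (m * (Real.exp (-s / κ) * Γ x 0) / κ))
    simp only [← hμdef]
    ring
  · intro s hs
    set K := exp (s • (glauber μ - 1)) * resolvent (glauber μ) with hKdef
    have hK := (rowStochastic ℝ (Fin n → S)).mul_mem (exp_generator_mem_rowStochastic hP hs)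
      (resolvent_mem_rowStochastic hP)
    rw [← hKdef] at hK
    have hμK : μ ᵥ* K = μ := vecMul_exp_mul_resolvent hP hb hs
    have hνK : ∀ a z, 0 ≤ (ν a ᵥ* K) z := fun a =>
      nonneg_vecMul_of_mem_rowStochastic hK (hν a).1
    -- Here b_a = d(ν_a K)/dμ; the weights ρ(a) b_a sum to 1 because K preserves μ = Σ ρ(a) ν_a.
    have hmom := sum_prod_mul_exp_klFun_le hμ hρ (b := fun a z => (ν a ᵥ* K) z / μ z)
      (fun a z => div_nonneg (hνK a z) (hμ z)) (fun z hz => ?_) (fun a => ?_) hm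
    · rw [Fintype.card_fin] at hmom
      refine le_trans (le_of_eq ?_) hmom
      refine Finset.sum_congr rfl fun x _ => ?_
      congr 2
      simp only [hD, hf, dotProduct_mulVec_empiricalDensity]
      ring
    · simp only [← mul_div_assoc]
      rw [← Finset.sum_div]
      have : ∑ a, ρ a * (ν a ᵥ* K) z = μ z := by
        conv_rhs => rw [← hμK]
        simp only [vecMul, dotProduct]
        rw [sum_mixture_mul]
      rw [this, div_self hz]
    · calc ∑ z, μ z * ((ν a ᵥ* K) z / μ z) ≤ ∑ z, (ν a ᵥ* K) z := by
            refine Finset.sum_le_sum fun z _ => ?_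
            by_cases hz : μ z = 0
            · rw [hz, zero_mul]; exact hνK a z
            · rw [mul_div_cancel₀ _ hz]
        _ = 1 := by
            have h1 := vecMul_dotProduct_one_eq_one_rowStochastic hK (x := ν a)
              (by rw [dotProduct_one]; exact (hν a).2)
            rwa [dotProduct_one] at h1

end Main

end GlauberMixture

/-! ### The main theorem -/

open GlauberMixture InformationTheory

theorem theorem3p5 :
    ∃ C₁ C₂ : ℝ, 0 < C₁ ∧ 0 < C₂ ∧
      ∀ (n k : ℕ) (S : Type*) [Fintype S] [DecidableEq S] [MeasurableSpace S]
        [MeasurableSingletonClass S]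
        (ρ : Fin k → ℝ) (ν : Fin k → (Fin n → S) → ℝ) (cstar ε δ : ℝ) (m : ℕ) (t : ℝ),
        1 ≤ n →
        ρ ∈ stdSimplex ℝ (Fin k) →
        (∀ a, ν a ∈ stdSimplex ℝ (Fin n → S)) →
        0 < cstar →
        (∀ a, GlauberMixture.SatisfiesMLSI (ν a) cstar) →
        0 < ε →
        0 < δ → δ < 1 →
        C₁ * (k / ε + Real.log (1 / δ) / ε) ≤ m →
        C₂ * (cstar * n *
          max 1 (Real.log (Real.log (1 / GlauberMixture.minMass (GlauberMixture.mixture ρ ν)))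
            + Real.log (1 / ε))) ≤ t →
        MeasureTheory.Measure.pi
            (fun _ : Fin m => GlauberMixture.toMeasure (GlauberMixture.mixture ρ ν))
            {x | ENNReal.ofReal ε <
              InformationTheory.klDiv
                (GlauberMixture.toMeasure
                  (GlauberMixture.glauberLaw (GlauberMixture.mixture ρ ν) t
                    (GlauberMixture.empirical x)))
                (GlauberMixture.toMeasure (GlauberMixture.mixture ρ ν))}
          ≤ ENNReal.ofReal δ := by
  have hlogC : 0 < Real.log 20736 := Real.log_pos (by norm_num)
  -- 20736 = 2 · 10368: half of the smoothed entropy ε/10368 is left to the decaying initial term.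
  -- 62208 = 3 · 20736 absorbs the exponent 3k.
  refine ⟨62208, 20 * (1 + Real.log 20736), by norm_num, by positivity, ?_⟩
  intro n k S _ _ _ _ ρ ν c ε δ m t hn hρ hν hc hmlsi hε hδ hδ1 hm ht
  set μ := mixture ρ ν with hμdef
  have hμ : ∀ x, 0 ≤ μ x := mixture_nonneg hρ hν
  have hμ1 : ∑ x, μ x = 1 := sum_mixture hρ hν
  have hP := glauber_mem_rowStochastic hn hμ
  have hb := detailedBalance_glauber hμ
  have hn0 : (0 : ℝ) < n := by exact_mod_cast hn
  set Λ := Real.log (1 / minMass μ) with hΛ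
  set y := Real.log Λ + Real.log (1 / ε) with hy
  have hmax1 : 1 ≤ max 1 y := le_max_left _ _
  have ht0 : 0 ≤ t := le_trans (by positivity) ht
  have hlogδ : 0 < Real.log (1 / δ) := Real.log_pos ((one_lt_div hδ).2 hδ1)
  have hmpos : 0 < (m : ℝ) := lt_of_lt_of_le (by positivity) hm
  have hm0 : m ≠ 0 := by exact_mod_cast hmpos.ne'
  have hmε : 62208 * (k + Real.log (1 / δ)) ≤ m * ε := by
    rw [← add_div, ← mul_div_assoc, div_le_iff₀ hε] at hm
    exact hm
  set κ := 20 * n * c with hκ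
  have hκ0 : 0 < κ := by positivity
  have htκ : y + Real.log 20736 ≤ t / κ := by
    rw [le_div_iff₀ hκ0]
    refine le_trans ?_ ht
    have h1 : y + Real.log 20736 ≤ (1 + Real.log 20736) * max 1 y := by
      nlinarith [le_max_right 1 y]
    calc (y + Real.log 20736) * κ ≤ ((1 + Real.log 20736) * max 1 y) * κ := by gcongr
      _ = _ := by rw [hκ]; ring
  have hdecay : Real.exp (-t / κ) * Λ ≤ ε / 20736 := by
    -- For a point mass Λ = 0 and `Real.log 0 = 0`, in agreement with the convention of the theorem;
    -- the bound is then trivial.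
    rcases le_or_gt Λ 0 with h0 | h0
    · exact (mul_nonpos_of_nonneg_of_nonpos (Real.exp_pos _).le h0).trans (by positivity)
    · rw [← Real.exp_log h0, ← Real.exp_add, ← Real.exp_log (show 0 < ε / 20736 by positivity)]
      refine Real.exp_le_exp.2 ?_
      rw [Real.log_div hε.ne' (by norm_num), neg_div]
      have h2 : Real.log (1 / ε) = -Real.log ε := by rw [one_div, Real.log_inv]
      rw [hy, h2] at htκ
      linarith
  have hmom := sum_prod_mul_exp_entropy_le hn hρ hν hc hmlsi hm0 ht0
  refine (pi_toMeasure_le_of_exp hμ (z := m * ε / 20736) (Z := fun x => m *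
    (∑ y, μ y * klFun (smoothed (glauber μ) (empiricalDensity μ x) t y) -
      Real.exp (-t / κ) * ∑ y, μ y * klFun (smoothed (glauber μ) (empiricalDensity μ x) 0 y)))
    fun x hx hx0 => ?_).trans (ENNReal.ofReal_le_ofReal ?_)
  -- On the bad event with samples in the support, the smoothed entropy exceeds ε/10368 and the
  -- decaying term is at most ε/20736, so their difference is at least ε/20736.
  · set f := empiricalDensity μ x with hf
    have hf0 : ∀ y, 0 ≤ f y := fun y => empiricalDensity_nonneg hμ x y
    have hf1 : ∑ z, μ z * f z = 1 := sum_mul_empiricalDensity hm0 hx0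
    have hlaw : glauberLaw μ t (empirical x) = fun z =>
        μ z * (Matrix.mulVec (NormedSpace.exp (t • (glauber μ - 1))) f) z := by
      rw [← (hb.exp_generator t).vecMul_mul f]
      unfold glauberLaw
      congr 1
      ext z
      exact (mul_empiricalDensity hx0 z).symm
    have hft := Matrix.nonneg_mulVec_of_mem_rowStochastic
      (exp_generator_mem_rowStochastic hP ht0) hf0
    rw [Set.mem_ofPred_eq, hlaw, klDiv_toMeasure_mul hμ hft, ENNReal.ofReal_lt_ofReal_iff'] at hx
    have h1 := hx.1.le.trans (sum_klFun_exp_mulVec_le hP hb ht0 hμ hf0)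
    have h2 := (sum_klFun_smoothed_zero_le hP hb hμ hf0).trans
      (sum_klFun_le_log_inv_minMass hμ hμ1 hf0 hf1)
    have h3 := (mul_le_mul_of_nonneg_left h2 (Real.exp_pos (-t / κ)).le).trans hdecay
    rw [mul_div_assoc]
    refine mul_le_mul_of_nonneg_left ?_ hmpos.le
    linarith
  · calc Real.exp (-(m * ε / 20736)) * _ ≤ Real.exp (-(m * ε / 20736)) * Real.exp (3 * k) := by
          gcongr
      _ = Real.exp (3 * k - m * ε / 20736) := by rw [← Real.exp_add]; ring_nf
      _ ≤ Real.exp (Real.log δ) := by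
          refine Real.exp_le_exp.2 ?_
          have h1 : Real.log (1 / δ) = -Real.log δ := by rw [one_div, Real.log_inv]
          rw [h1] at hmε hlogδ
          linarith
      _ = δ := Real.exp_log hδ
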